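/- Conventions. $C^*$-algebras are complex and need not be unital, and isomorphisms of $C^*$-algebras are $*$-isomorphisms. A representation of a $C^*$-algebra $A$ is a $*$-homomorphism $\pi\colon A\to B(H)$ with $H$ a complex Hilbert space; it is irreducible if the only closed $\pi(A)$-invariant subspaces of $H$ are $\{0\}$ and $H$, and $n$-dimensional if $\dim H=n$. Let $n\ge 1$ be an integer, let $M_n$ be the $C^*$-algebra of complex $n\times n$ matrices, $U(n)$ its unitary group, $\mathbb T=\{z\in\mathbb C:|z|=1\}$, and let $\mathfrak U_n=U(n)/(\mathbb T\cdot I)$ be the quotient topological group. It acts on $M_n$ by $\mathfrak u.A=UAU^{-1}$, where $U\in U(n)$ is any representative of $\mathfrak u$. An $n$-space $(X,.)$ is a (possibly empty) locally compact Hausdorff space $X$ with a continuous free action $\mathfrak U_n\times X\to X$ (free: $\mathfrak u.x=x$ for some $x\in X$ implies that $\mathfrak u$ is the neutral element). For an $n$-space $(X,.)$ let $C^*(X,.)$ be the $C^*$-algebra of all $f\in C_0(X,M_n)$ such that $f(\mathfrak u.x)=\mathfrak u.f(x)$ for all $\mathfrak u\in\mathfrak U_n$ and $x\in X$. A morphism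 of $n$-spaces is a proper continuous $\mathfrak U_n$-equivariant map, and an isomorphism of $n$-spaces is a morphism that is a homeomorphism. A $C^*$-algebra $A$ is $n$-homogeneous if every nonzero irreducible representation of $A$ is $n$-dimensional. Theorem (Fell's characterization). For every $C^*$-algebra $A$ and every integer $n\ge 1$ the following conditions are equivalent: (i) $A$ is $n$-homogeneous; (ii) there is an $n$-space $(X,.)$ such that $A$ is isomorphic to $C^*(X,.)$. Moreover, if $A$ is $n$-homogeneous, then the $n$-space $(X,.)$ in (ii) is unique up to isomorphism: if $(X,.)$ and $(Y,*)$ are $n$-spaces such that $A$ is isomorphic to $C^*(X,.)$ and to $C^*(Y,*)$, then $(X,.)$ and $(Y,*)$ are isomorphic $n$-spaces. -/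

import Mathlib

universe u v w

noncomputable section

open scoped ZeroAtInfty Matrix.Norms.L2Operator

namespace Fell

/-- The C*-algebra `M_n` of complex `n × n` matrices (with the operator norm). -/
abbrev Mat (n : ℕ) : Type := Matrix (Fin n) (Fin n) ℂ

/-- The subgroup `𝕋 · I` of the unitary group `U(n)`: the unitary scalar matrices
(the scalar of such a matrix is automatically of modulus one if `n ≥ 1`). -/
def scalarUnitary (n : ℕ) : Subgroup (Matrix.unitaryGroup (Fin n) ℂ) where
  carrier := {U | ∃ z : ℂ, ‖z‖ = 1 ∧ (U : Mat n) = z • (1 : Mat n)}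
  one_mem' := ⟨1, by simp, by simp⟩
  mul_mem' := by
    rintro U V ⟨z, hz, hU⟩ ⟨t, ht, hV⟩
    exact ⟨z * t, by simp [hz, ht], by simp [hU, hV, smul_smul, mul_comm]⟩
  inv_mem' := by
    rintro U ⟨z, hz, hU⟩
    exact ⟨star z, by simp [hz], by
      rw [Matrix.UnitaryGroup.inv_val, hU, star_smul, star_one]⟩

instance scalarUnitary_normal (n : ℕ) : (scalarUnitary n).Normal where
  conj_mem := by
    rintro U ⟨z, hz, hU⟩ V
    refine ⟨z, hz, ?_⟩
    have h : (V : Mat n) * star (V : Mat n) = 1 := Unitary.mul_star_self_of_mem V.2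
    simp [hU, h]

/-- The compact group `U(n) / (𝕋 · I)`, with the quotient group structure and the quotient
topology. -/
abbrev PU (n : ℕ) : Type := Matrix.unitaryGroup (Fin n) ℂ ⧸ scalarUnitary n

/-- The action of `U(n) / (𝕋 · I)` on `M_n`: the class of `U` acts by `A ↦ U A U⁻¹`. -/
def conj (n : ℕ) : PU n →* (Mat n ≃⋆ₐ[ℂ] Mat n) :=
  QuotientGroup.lift (scalarUnitary n) (Unitary.conjStarAlgAut ℂ (Mat n)) (by
    rintro U ⟨z, hz, hU⟩
    have hzz : z * star z = 1 := by
      simp [Complex.mul_conj, Complex.normSq_eq_norm_sq, hz]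
    ext1 A
    simp only [Unitary.conjStarAlgAut_apply, hU, star_smul, star_one,
      smul_mul_assoc, one_mul, mul_smul_comm, mul_one, smul_smul]
    rw [mul_comm, hzz]
    simp)

theorem conj_mk (n : ℕ) (U : Matrix.unitaryGroup (Fin n) ℂ) (A : Mat n) :
    conj n (QuotientGroup.mk U) A = (U : Mat n) * A * star (U : Mat n) := rfl

/-- An `n`-space: a locally compact Hausdorff space with a continuous free action of
`U(n) / (𝕋 · I)`. -/
structure NSpace (n : ℕ) : Type (u + 1) where
  carrier : Type u
  [topology : TopologicalSpace carrier]
  [t2 : T2Space carrier]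
  [locallyCompact : LocallyCompactSpace carrier]
  [action : MulAction (PU n) carrier]
  [continuous_action : ContinuousSMul (PU n) carrier]
  free : ∀ (g : PU n) (x : carrier), g • x = x → g = 1

namespace NSpace

variable {n : ℕ}

instance : CoeSort (NSpace.{u} n) (Type u) := ⟨NSpace.carrier⟩

attribute [instance] topology t2 locallyCompact action continuous_action

/-- A morphism of `n`-spaces: a proper continuous equivariant map. -/
structure IsMorphism (X : NSpace.{v} n) (Y : NSpace.{w} n) (f : X → Y) : Prop where
  continuous : Continuous f
  isCompact_preimage : ∀ K : Set Y, IsCompact K → IsCompact (f ⁻¹' K)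
  map_smul : ∀ (g : PU n) (x : X), f (g • x) = g • f x

/-- Two `n`-spaces are isomorphic if some morphism between them is a homeomorphism. -/
def Isomorphic (X : NSpace.{v} n) (Y : NSpace.{w} n) : Prop :=
  ∃ e : X ≃ₜ Y, IsMorphism X Y e

/-- The C*-algebra `C*(X, .)` of all equivariant functions in `C₀(X, M_n)`. -/
def cstar (X : NSpace.{u} n) : NonUnitalStarSubalgebra ℂ C₀(X, Mat n) where
  carrier := {f | ∀ (g : PU n) (x : X), f (g • x) = conj n g (f x)}
  add_mem' := by
    intro f₁ f₂ h₁ h₂ g x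
    simp [h₁ g x, h₂ g x]
  zero_mem' := by
    intro g x
    simp
  mul_mem' := by
    intro f₁ f₂ h₁ h₂ g x
    simp [h₁ g x, h₂ g x]
  smul_mem' := by
    intro c f h g x
    simp [h g x]
  star_mem' := by
    intro f h g x
    simp [h g x, map_star]

theorem mem_cstar (X : NSpace.{u} n) (f : C₀(X, Mat n)) :
    f ∈ X.cstar ↔ ∀ (g : PU n) (x : X), f (g • x) = conj n g (f x) := Iff.rfl

/-- `C*(X, .)` is norm closed in `C₀(X, M_n)`, hence a C*-algebra. -/
instance isClosed_cstar (X : NSpace.{u} n) : IsClosed (X.cstar : Set C₀(X, Mat n)) := by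
  have hev : ∀ x : X, Continuous fun f : C₀(X, Mat n) => f x := fun x =>
    (continuous_eval_const (F := BoundedContinuousFunction X (Mat n)) x).comp ZeroAtInftyContinuousMap.isometry_toBCF.continuous
  have hconj : ∀ g : PU n, Continuous (conj n g) := by
    intro g
    induction g using QuotientGroup.induction_on with
    | H U =>
      simp only [funext (conj_mk n U)]
      fun_prop
  have : (X.cstar : Set C₀(X, Mat n)) =
      ⋂ (g : PU n) (x : X), {f | f (g • x) = conj n g (f x)} := by
    ext f
    simp [mem_cstar]
  rw [this]
  exact isClosed_iInter fun g => isClosed_iInter fun x =>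
    isClosed_eq (hev _) ((hconj g).comp (hev x))

end NSpace

/-- A representation `π` of `A` on a Hilbert space `H` is irreducible if the only closed
subspaces of `H` which are invariant under `π` are the trivial ones. -/
def IsIrreducible {A : Type u} [NonUnitalCStarAlgebra A] {H : Type v} [NormedAddCommGroup H]
    [InnerProductSpace ℂ H] [CompleteSpace H] (π : A →⋆ₙₐ[ℂ] (H →L[ℂ] H)) : Prop :=
  ∀ K : Submodule ℂ H, IsClosed (K : Set H) → (∀ a : A, ∀ x ∈ K, π a x ∈ K) → K = ⊥ ∨ K = ⊤

/-- A C*-algebra is `n`-homogeneous if all its nonzero irreducible representations are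
`n`-dimensional. An irreducible representation has a dense orbit `π(A)x`, so its Hilbert space
is a completion of a quotient of `A`; hence Hilbert spaces in the universe of `A` suffice. -/
def IsHomogeneous (n : ℕ) (A : Type u) [NonUnitalCStarAlgebra A] : Prop :=
  ∀ (H : Type u) [NormedAddCommGroup H] [InnerProductSpace ℂ H] [CompleteSpace H]
    (π : A →⋆ₙₐ[ℂ] (H →L[ℂ] H)), π ≠ 0 → IsIrreducible π →
      FiniteDimensional ℂ H ∧ Module.finrank ℂ H = n

end Fell

end

/-! An `n`-homogeneous `A` is recovered from `Spec n A`, its nonzero `*`-homomorphisms to `M_n`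
under pointwise convergence, on which `PU n` acts by conjugation. Burnside's theorem makes each of
them surjective (`IsHomogeneous.surjective`), so the action is free. Contractivity and Tychonoff
give local compactness, the zero homomorphism being the point at infinity. The Gelfand map sends `a`
to evaluation at `a`. It is injective because irreducible representations separate points
(Krein–Milman and GNS, `exists_isIrreducible`) and are `n`-dimensional by assumption. It is onto by
a Stone–Weierstrass argument (`IsRich.bijective`): its range contains scalar-valued bump functions
around orbits, built by moving a rank-one projection along a basis, and these glue local
approximations.

Conversely, the kernel of an irreducible representation of `X.cstar` is prime, and compactness then
forces it to contain the kernel of evaluation at some point (`exists_eval_ker_le`). The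
representation thus factors through `M_n`, whose nonzero irreducible representations have dimension
`n`.

For uniqueness the same lemma applies to surjections `X.cstar → M_n`. Up to conjugation, hence up to
moving the point in its orbit, each is an evaluation, because automorphisms of `M_n` are inner
(`exists_eq_conj`). Tietze extension and Haar averaging supply enough elements of `X.cstar` for
evaluations to be surjective and to separate points, and they determine the topology
(`isInducing_eval`). So an isomorphism of algebras induces one of `n`-spaces. -/

noncomputable section

open scoped ZeroAtInfty Matrix.Norms.L2Operator

namespace Fell

/-! ### Factoring through a surjection -/

section Factor

variable {A B D : Type*} [NonUnitalNonAssocSemiring A] [Module ℂ A] [Star A]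
  [NonUnitalNonAssocSemiring B] [Module ℂ B] [Star B]
  [NonUnitalNonAssocSemiring D] [Module ℂ D] [Star D]

/-- A `*`-homomorphism that identifies all points identified by a surjective `*`-homomorphism
factors through it. -/
theorem exists_starAlgHom_comp_eq (φ : A →⋆ₙₐ[ℂ] B) (hφ : Function.Surjective φ)
    (π : A →⋆ₙₐ[ℂ] D) (h : ∀ a b, φ a = φ b → π a = π b) :
    ∃ ρ : B →⋆ₙₐ[ℂ] D, ∀ a, ρ (φ a) = π a := by
  have hs := Function.surjInv_eq hφ
  have key : ∀ a b, φ a = b → π (Function.surjInv hφ b) = π a := fun a b hab =>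
    h _ _ ((hs b).trans hab.symm)
  refine ⟨⟨⟨⟨⟨fun b => π (Function.surjInv hφ b), ?_⟩, ?_, ?_⟩, ?_⟩, ?_⟩, fun a => key _ _ rfl⟩
  · intro c b
    rw [key (c • Function.surjInv hφ b) _ (by rw [map_smul, hs]), map_smul]; rfl
  · exact (key 0 _ (map_zero φ)).trans (map_zero π)
  · intro b b'
    change π (Function.surjInv hφ (b + b')) = _
    rw [key (Function.surjInv hφ b + Function.surjInv hφ b') _ (by rw [map_add, hs, hs]), map_add]
  · intro b b'
    change π (Function.surjInv hφ (b * b')) = _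
    rw [key (Function.surjInv hφ b * Function.surjInv hφ b') _ (by rw [map_mul, hs, hs]), map_mul]
  · intro b
    change π (Function.surjInv hφ (star b)) = _
    rw [key (star (Function.surjInv hφ b)) _ (by rw [map_star, hs]), map_star]

end Factor

/-! ### Matrix algebras: conjugation, ideals, automorphisms, representations -/

section MatrixAlgebra

variable {n : ℕ}

theorem eq_one_of_conj_eq (g : PU n) (h : ∀ T, conj n g T = T) : g = 1 := by
  induction g using QuotientGroup.induction_on with
  | H U =>
    rw [QuotientGroup.eq_one_iff]
    have h1 : Unitary.conjStarAlgAut ℂ (Mat n) U = Unitary.conjStarAlgAut ℂ (Mat n) 1 := by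
      ext1 T
      rw [map_one]
      exact h T
    obtain ⟨α, hα⟩ := (Unitary.conjStarAlgAut_ext_iff' U 1).1 h1
    refine ⟨α, ?_, by rw [hα]; rfl⟩
    simp

theorem continuous_conj : Continuous fun p : PU n × Mat n => conj n p.1 p.2 := by
  have hq : IsOpenQuotientMap (Prod.map (QuotientGroup.mk : _ → PU n) (id : Mat n → Mat n)) :=
    QuotientGroup.isOpenQuotientMap_mk.prodMap .id
  rw [hq.isQuotientMap.continuous_iff]
  change Continuous fun p : Matrix.unitaryGroup (Fin n) ℂ × Mat n =>
    (p.1 : Mat n) * p.2 * star (p.1 : Mat n)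
  fun_prop

instance compactSpace_unitaryGroup : CompactSpace (Matrix.unitaryGroup (Fin n) ℂ) := by
  suffices h : IsCompact (Matrix.unitaryGroup (Fin n) ℂ : Set (Mat n)) from
    isCompact_iff_compactSpace.1 h
  refine Metric.isCompact_of_isClosed_isBounded isClosed_unitary ?_
  refine (Metric.isBounded_closedBall (x := (0 : Mat n)) (r := 1)).subset fun U hU => ?_
  rw [mem_closedBall_zero_iff]
  rcases subsingleton_or_nontrivial (Mat n) with hn | hn
  · simp [Subsingleton.elim U 0]
  · exact (CStarRing.norm_of_mem_unitary hU).le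

theorem norm_conj (g : PU n) (T : Mat n) : ‖conj n g T‖ = ‖T‖ :=
  NonUnitalStarAlgHom.norm_map (conj n g) (conj n g).injective T

theorem conj_inv_conj (g : PU n) (T : Mat n) : conj n g⁻¹ (conj n g T) = T := by
  rw [map_inv]
  exact (conj n g).symm_apply_apply T

theorem conj_conj (g h : PU n) (T : Mat n) : conj n g (conj n h T) = conj n (g * h) T := by
  rw [map_mul]; rfl

/-- Puts the unit into the two-sided ideal generated by a matrix with a nonzero entry; this is how
simplicity of `M_n` enters below. -/
theorem sum_single_mul_single (T : Mat n) (i j : Fin n) :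
    ∑ k, Matrix.single k i 1 * T * Matrix.single j k 1 = T i j • (1 : Mat n) := by
  ext a b
  simp only [Matrix.single_mul_mul_single, Matrix.sum_apply, one_mul, mul_one, Matrix.smul_apply,
    Matrix.one_apply, Matrix.single_apply, smul_eq_mul]
  rw [Finset.sum_eq_single a] <;> simp +contextual

theorem eq_zero_or_eq_zero_of_mul_mul (S T : Mat n) (h : ∀ C, S * C * T = 0) : S = 0 ∨ T = 0 := by
  by_contra! hST
  obtain ⟨hS, hT⟩ := hST
  obtain ⟨i, j, hij⟩ : ∃ i j, S i j ≠ 0 := by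
    by_contra! h0
    exact hS (by ext i j; exact h0 i j)
  apply hT
  have h1 : (S i j • (1 : Mat n)) * T = 0 := by
    rw [← sum_single_mul_single, Finset.sum_mul]
    refine Finset.sum_eq_zero fun k _ => ?_
    rw [mul_assoc, mul_assoc, ← mul_assoc S, h, mul_zero]
  simpa [hij] using h1

/-- The trace of an idempotent is its rank, so `p` is an outer product of two vectors, and
sandwiching `B` between two copies leaves a scalar. -/
theorem mul_mul_eq_trace_smul (p B : Mat n) (hp : p * p = p) (ht : p.trace = 1) :
    p * B * p = (p * B).trace • p := by
  have hid : IsIdempotentElem (Matrix.toLin' p) := by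
    rw [IsIdempotentElem, Module.End.mul_eq_comp, ← Matrix.toLin'_mul, hp]
  have hr : Module.finrank ℂ (LinearMap.range (Matrix.toLin' p)) = 1 := by
    have := (LinearMap.IsIdempotentElem.isProj_range _ hid).trace
    rw [Matrix.trace_toLin'_eq, ht] at this
    exact_mod_cast this.symm
  obtain ⟨v, -, hv⟩ := finrank_eq_one_iff'.1 hr
  choose c hc using fun j : Fin n =>
    hv ⟨Matrix.toLin' p (Pi.single j 1), LinearMap.mem_range_self _ _⟩
  have hpv : p = Matrix.vecMulVec v.1 c := by
    ext i j
    have := congrFun (congrArg Subtype.val (hc j)) i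
    simp only [Submodule.coe_smul, Pi.smul_apply, smul_eq_mul, Matrix.toLin'_apply,
      Matrix.mulVec_single_one, Matrix.col_apply] at this
    rw [← this, Matrix.vecMulVec_apply, mul_comm]
  rw [hpv, Matrix.vecMulVec_mul, Matrix.vecMulVec_mul_vecMulVec, Matrix.trace_vecMulVec,
    dotProduct_comm]
  ext i j
  simp [Matrix.vecMulVec_apply, mul_assoc, mul_comm, mul_left_comm]

/-- By dimension `α` is bijective, and a `*`-automorphism of the operators on a Hilbert space is
implemented by a unitary. -/
theorem exists_eq_conj (α : Mat n →⋆ₙₐ[ℂ] Mat n) (hα : Function.Surjective α) :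
    ∃ g : PU n, ∀ T, α T = conj n g T := by
  have hinj : Function.Injective α :=
    (LinearMap.injective_iff_surjective (f := (α : Mat n →ₗ[ℂ] Mat n))).2 hα
  let β : Mat n ≃⋆ₐ[ℂ] Mat n := StarAlgEquiv.ofBijective α ⟨hinj, hα⟩
  let E := Matrix.toEuclideanCLM (n := Fin n) (𝕜 := ℂ)
  obtain ⟨U, hU⟩ := StarAlgEquiv.eq_linearIsometryEquivConjStarAlgEquiv
    ((E.symm.trans β).trans E)
    (LinearMap.continuous_of_finiteDimensional
      (((E.symm.trans β).trans E).toAlgEquiv.toLinearMap))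
  let u := Unitary.linearIsometryEquiv.symm U
  obtain ⟨V, hV⟩ : ∃ V, E V = u := E.surjective u
  have hVu : V ∈ Matrix.unitaryGroup (Fin n) ℂ := by
    constructor <;> apply EquivLike.injective E <;> rw [map_mul, map_star, map_one, hV]
    · exact Unitary.star_mul_self_of_mem u.2
    · exact Unitary.mul_star_self_of_mem u.2
  refine ⟨QuotientGroup.mk ⟨V, hVu⟩, fun T => ?_⟩
  rw [conj_mk]
  apply EquivLike.injective E
  have h1 : E (α T) = U.conjStarAlgEquiv (E T) := by
    rw [← hU]
    simp only [StarAlgEquiv.trans_apply, StarAlgEquiv.symm_apply_apply]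
    rfl
  rw [h1, map_mul, map_mul, map_star]
  change _ = E V * E T * star (E V)
  rw [hV, ← Unitary.conjStarAlgAut_symm_unitaryLinearIsometryEquiv]
  rfl

/-- The matrix units of one column, applied to a vector `w` not killed by the diagonal one, span an
invariant copy of `ℂ^n`, which irreducibility makes all of `H`. -/
theorem finrank_eq_of_isIrreducible {H : Type*} [NormedAddCommGroup H] [InnerProductSpace ℂ H]
    [CompleteSpace H] (π : Mat n →⋆ₙₐ[ℂ] (H →L[ℂ] H)) (h0 : π ≠ 0) (hπ : IsIrreducible π) :
    FiniteDimensional ℂ H ∧ Module.finrank ℂ H = n := by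
  obtain ⟨i, hi⟩ : ∃ i, π (Matrix.single i i 1) ≠ 0 := by
    by_contra! h1
    apply h0
    ext1 T
    have : π 1 = 0 := by
      rw [← Matrix.sum_single_one, map_sum]
      exact Finset.sum_eq_zero fun i _ => h1 i
    rw [← mul_one T, map_mul, this, mul_zero]; rfl
  obtain ⟨w, hw⟩ : ∃ w, π (Matrix.single i i 1) w ≠ 0 := by
    by_contra! h1
    exact hi (by ext1 w; exact h1 w)
  let b : Fin n → H := fun k => π (Matrix.single k i 1) w
  have hb : ∀ T k, π T (b k) = ∑ l, T l k • b l := by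
    intro T k
    have : T * Matrix.single k i 1 = ∑ l, T l k • Matrix.single l i (1 : ℂ) := by
      ext a c
      rw [Matrix.sum_apply, Finset.sum_eq_single a]
      · by_cases hc : i = c
        · subst hc; simp
        · simp [hc, Matrix.mul_apply]
      · intro l _ hl; simp [hl]
      · simp
    calc π T (b k) = π (T * Matrix.single k i 1) w := by rw [map_mul]; rfl
      _ = _ := by
        rw [this, map_sum, sum_apply]
        exact Finset.sum_congr rfl fun l _ => by rw [map_smul]; rfl
  have hli : LinearIndependent ℂ b := by
    rw [Fintype.linearIndependent_iff]
    intro c hc k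
    have := congrArg (π (Matrix.single i k 1)) hc
    rw [map_sum, map_zero, Finset.sum_eq_single k, map_smul, hb, Finset.sum_eq_single i] at this
    · simpa [b, hw] using this
    · intro l _ hl; simp [hl.symm]
    · simp
    · intro l _ hl
      rw [map_smul, hb, Finset.sum_eq_zero, smul_zero]
      intro m _
      simp [hl.symm]
    · simp
  have hspan : Submodule.span ℂ (Set.range b) = ⊤ := by
    have := FiniteDimensional.span_of_finite ℂ (Set.finite_range b)
    refine (hπ (Submodule.span ℂ (Set.range b)) (Submodule.closed_of_finiteDimensional _) fun T x hx => ?_).resolve_left ?_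
    · induction hx using Submodule.span_induction with
      | mem x hx =>
        obtain ⟨k, rfl⟩ := hx
        rw [hb]
        exact Submodule.sum_mem _ fun l _ =>
          Submodule.smul_mem _ _ (Submodule.subset_span ⟨l, rfl⟩)
      | zero => simp
      | add x y _ _ hx hy => rw [map_add]; exact add_mem hx hy
      | smul c x _ hx => rw [map_smul]; exact Submodule.smul_mem _ _ hx
    · intro h1
      have : b i ∈ Submodule.span ℂ (Set.range b) := Submodule.subset_span ⟨i, rfl⟩
      rw [h1] at this
      exact hw this
  let B := Module.Basis.mk hli hspan.ge
  exact ⟨B.finiteDimensional_of_finite, by rw [Module.finrank_eq_card_basis B, Fintype.card_fin]⟩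

end MatrixAlgebra

/-! ### States, Krein–Milman and the GNS representation -/

section States

open scoped ComplexOrder InnerProductSpace

variable (B : Type u) [CStarAlgebra B] [PartialOrder B] [StarOrderedRing B]

/-- The states of a unital C*-algebra, as functions. -/
def states : Set (B → ℂ) :=
  {f | (∀ a b, f (a + b) = f a + f b) ∧ (∀ (c : ℂ) (a), f (c • a) = c * f a) ∧
    (∀ a, 0 ≤ a → 0 ≤ f a) ∧ f 1 = 1}

variable {B}

/-- A state as a positive linear functional. -/
def states.toPositive {f : B → ℂ} (hf : f ∈ states B) : B →ₚ[ℂ] ℂ :=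
  PositiveLinearMap.mk₀ ⟨⟨f, hf.1⟩, hf.2.1⟩ hf.2.2.1

theorem states.toPositive_apply {f : B → ℂ} (hf : f ∈ states B) (a : B) :
    states.toPositive hf a = f a := rfl

/-- The factor 4 counts the positive parts of `a`; it is not sharp, but any bound independent of `f`
suffices for Tychonoff. -/
theorem norm_le_of_mem_states {f : B → ℂ} (hf : f ∈ states B) (a : B) : ‖f a‖ ≤ 4 * ‖a‖ := by
  obtain ⟨y, hy0, hyn, hy⟩ := CStarAlgebra.exists_sum_four_nonneg a
  have h1 : ∀ i, ‖states.toPositive hf (y i)‖ ≤ ‖a‖ := fun i =>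
    ((states.toPositive hf).norm_apply_le_of_nonneg _ (hy0 i)).trans
      (by simpa [states.toPositive_apply, hf.2.2.2] using hyn i)
  change ‖states.toPositive hf a‖ ≤ _
  conv_lhs => rw [hy]
  rw [map_sum]
  refine (norm_sum_le _ _).trans ?_
  calc _ ≤ ∑ _i : Fin 4, ‖a‖ := Finset.sum_le_sum fun i _ => by
        rw [map_smul, norm_smul, norm_pow, Complex.norm_I, one_pow, one_mul]
        exact h1 i
    _ = _ := by simp

theorem isCompact_states : IsCompact (states B) := by
  have hc : IsCompact (Set.univ.pi fun a : B => Metric.closedBall (0 : ℂ) (4 * ‖a‖)) :=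
    isCompact_univ_pi fun a => isCompact_closedBall _ _
  refine hc.of_isClosed_subset ?_ fun f hf a _ => by
    simpa using norm_le_of_mem_states hf a
  simp only [states, Set.ofPred_and, Set.ofPred_forall]
  refine ((isClosed_iInter fun a => isClosed_iInter fun b => isClosed_eq ?_ ?_).inter
    ((isClosed_iInter fun c => isClosed_iInter fun a => isClosed_eq ?_ ?_).inter
    ((isClosed_iInter fun a => isClosed_iInter fun h => isClosed_le ?_ ?_).inter
      (isClosed_eq ?_ ?_)))) <;> fun_prop

/-- Hahn–Banach separates `-x` from the closed cone of positive elements. The functional is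
nonnegative on the cone by scaling, is extended complex-linearly from its values on real parts, and
is normalised at the unit. -/
theorem exists_mem_states_re_pos {x : B} (hx : 0 ≤ x) (hx0 : x ≠ 0) :
    ∃ f ∈ states B, 0 < (f x).re := by
  have hcv : Convex ℝ {a : B | 0 ≤ a} := convex_Ici (𝕜 := ℝ) (0 : B)
  have hcl : IsClosed {a : B | 0 ≤ a} := isClosed_Ici
  obtain ⟨l, r, hlx, hl⟩ := geometric_hahn_banach_point_closed (E := B) hcv hcl (x := -x)
    (fun h => hx0 (le_antisymm (neg_nonneg.1 h) hx))
  have hr : r < 0 := by simpa using hl 0 (le_refl (0 : B))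
  have hlx : 0 < l x := by
    rw [map_neg] at hlx
    linarith
  have hl0 : ∀ a : B, 0 ≤ a → 0 ≤ l a := by
    intro a ha
    by_contra! hneg
    have := hl ((r / l a) • a) (smul_nonneg (div_nonneg_of_nonpos hr.le hneg.le) ha)
    rw [map_smul, smul_eq_mul, div_mul_cancel₀ _ hneg.ne] at this
    exact lt_irrefl _ this
  let m : B →ₗ[ℝ] ℝ := (l : B →ₗ[ℝ] ℝ) ∘ₗ (selfAdjoint.submodule ℝ B).subtype ∘ₗ realPart
  let g : B →ₗ[ℂ] ℂ := Module.Dual.extendRCLike (𝕜 := ℂ) m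
  have hg : ∀ a : B, IsSelfAdjoint a → g a = (l a : ℂ) := by
    intro a ha
    have h1 : m a = l a := by
      change l (realPart a : B) = l a
      rw [ha.coe_realPart]
    have h2 : m (Complex.I • a) = 0 := by
      change l (realPart (Complex.I • a) : B) = 0
      rw [realPart_I_smul, ha.imaginaryPart]
      simp
    change ((m a : ℝ) : ℂ) - _ * ((m (Complex.I • a) : ℝ) : ℂ) = _
    rw [h1, h2]
    simp
  have h1 : 0 < l 1 := by
    have h2 : 0 ≤ l (‖x‖ • 1 - x) := hl0 _ (by
      rw [sub_nonneg, ← Algebra.algebraMap_eq_smul_one]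
      exact IsSelfAdjoint.le_algebraMap_norm_self (.of_nonneg hx))
    rw [map_sub, map_smul, smul_eq_mul] at h2
    by_contra! h3
    linarith [mul_nonpos_of_nonneg_of_nonpos (norm_nonneg x) h3]
  have hli : 0 ≤ (l 1)⁻¹ := inv_nonneg.2 h1.le
  refine ⟨fun a => ((l 1)⁻¹ : ℝ) * g a, ⟨?_, ?_, ?_, ?_⟩, ?_⟩
  · intro a b
    simp [mul_add]
  · intro c a
    simp only [map_smul, smul_eq_mul]
    ring
  · intro a ha
    simp only [hg a (.of_nonneg ha)]
    exact_mod_cast mul_nonneg hli (hl0 a ha)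
  · simp only [hg 1 (.one _)]
    rw [← Complex.ofReal_mul, inv_mul_cancel₀ h1.ne', Complex.ofReal_one]
  · simp only [hg x (.of_nonneg hx)]
    rw [← Complex.ofReal_mul, Complex.ofReal_re]
    exact mul_pos (inv_pos.2 h1) hlx

/-- The states maximising the real part at `x` form a compact exposed face, and an extreme point of
a face is extreme in the whole set. -/
theorem exists_extreme_state {x : B} (hx : 0 ≤ x) (hx0 : x ≠ 0) :
    ∃ f ∈ (states B).extremePoints ℝ, f x ≠ 0 := by
  obtain ⟨g, hg, hgx⟩ := exists_mem_states_re_pos hx hx0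
  let l : StrongDual ℝ (B → ℂ) := Complex.reCLM ∘L (ContinuousLinearMap.proj x)
  have hE : IsExposed ℝ (states B) (l.toExposed (states B)) :=
    ContinuousLinearMap.toExposed.isExposed
  have hne : (l.toExposed (states B)).Nonempty := by
    obtain ⟨f, hf, hmax⟩ := isCompact_states.exists_isMaxOn ⟨g, hg⟩ l.continuous.continuousOn
    exact ⟨f, hf, hmax⟩
  obtain ⟨f, hf⟩ := (hE.isCompact isCompact_states).extremePoints_nonempty hne
  refine ⟨f, hE.isExtreme.extremePoints_subset_extremePoints hf, fun h0 => ?_⟩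
  have := hf.1.2 g hg
  change (g x).re ≤ (f x).re at this
  rw [h0, Complex.zero_re] at this
  linarith

/-- An invariant `K` splits the cyclic vector as `Ω = ξ + η` along `K` and its complement. This
writes `f` as a convex combination of the vector states of `ξ` and `η`, so extremality identifies
the first with `f`, forcing `Ω` into `K`. -/
theorem isIrreducible_gns {f : B → ℂ} (hf : f ∈ (states B).extremePoints ℝ) :
    IsIrreducible (states.toPositive hf.1).gnsNonUnitalStarAlgHom := by
  set F := states.toPositive hf.1 with hF
  intro K hKc hK
  set π : B →⋆ₙₐ[ℂ] (F.GNS →L[ℂ] F.GNS) := F.gnsNonUnitalStarAlgHom with hπ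
  let Ω : F.GNS := (F.toPreGNS 1 : F.PreGNS)
  have hπΩ : ∀ a, π a Ω = (F.toPreGNS a : F.PreGNS) := by
    intro a
    change F.gnsNonUnitalStarAlgHom a (F.toPreGNS 1 : F.PreGNS) = _
    rw [PositiveLinearMap.gnsNonUnitalStarAlgHom_apply_coe]
    simp
  have hdense : ∀ K' : Submodule ℂ F.GNS, IsClosed (K' : Set F.GNS) → (∀ a, π a Ω ∈ K') →
      K' = ⊤ := by
    intro K' hc h
    rw [Submodule.eq_top_iff']
    intro v
    induction v using UniformSpace.Completion.induction_on with
    | hp => exact hc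
    | ih v => exact hπΩ (F.ofPreGNS v) ▸ h (F.ofPreGNS v)
  have hfΩ : ∀ a, f a = ⟪Ω, π a Ω⟫_ℂ := by
    intro a
    rw [hπΩ, UniformSpace.Completion.inner_coe, PositiveLinearMap.preGNS_inner_def]
    simp only [PositiveLinearMap.ofPreGNS_toPreGNS, star_one, one_mul]
    rfl
  have hadj : ∀ a (v w : F.GNS), ⟪v, π a w⟫_ℂ = ⟪π (star a) v, w⟫_ℂ := by
    intro a v w
    rw [map_star, ContinuousLinearMap.star_eq_adjoint, ContinuousLinearMap.adjoint_inner_left]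
  have hKo : ∀ a, ∀ v ∈ Kᗮ, π a v ∈ Kᗮ := by
    intro a v hv w hw
    rw [hadj]
    exact hv _ (hK _ _ hw)
  have : CompleteSpace K := hKc.completeSpace_coe
  obtain ⟨ξ, hξ, η, hη, hΩ⟩ : ∃ ξ ∈ K, ∃ η ∈ Kᗮ, Ω = ξ + η :=
    ⟨_, K.starProjection_apply_mem Ω, _, K.sub_starProjection_mem_orthogonal Ω, by simp⟩
  by_cases hξ0 : ξ = 0
  · left
    have h1 := hdense Kᗮ K.isClosed_orthogonal fun a => hKo a _ (by rw [hΩ, hξ0, zero_add]; exact hη)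
    exact (Submodule.orthogonal_eq_top_iff K).1 h1
  by_cases hη0 : η = 0
  · right
    exact hdense K hKc fun a => hK a _ (by rw [hΩ, hη0, add_zero]; exact hξ)
  right
  have hsum : ∀ a, f a = ⟪ξ, π a ξ⟫_ℂ + ⟪η, π a η⟫_ℂ := by
    intro a
    rw [hfΩ, hΩ, map_add, inner_add_left, inner_add_right, inner_add_right,
      hKo a η hη ξ hξ, Submodule.inner_left_of_mem_orthogonal (hK a ξ hξ) hη]
    ring
  have hpos : ∀ v : F.GNS, ∀ a, 0 ≤ a → 0 ≤ ⟪v, π a v⟫_ℂ := by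
    intro v a ha
    obtain ⟨b, rfl⟩ := CStarAlgebra.nonneg_iff_eq_star_mul_self.1 ha
    rw [map_mul, mul_apply_eq_comp, hadj, star_star, inner_self_eq_norm_sq_to_K]
    rw [← RCLike.ofReal_pow]
    exact RCLike.ofReal_nonneg.2 (sq_nonneg _)
  have hone : π 1 = 1 := map_one F.gnsStarAlgHom
  have hmem : ∀ v : F.GNS, v ≠ 0 →
      (fun a => (((‖v‖ ^ 2)⁻¹ : ℝ) : ℂ) * ⟪v, π a v⟫_ℂ) ∈ states B := by
    intro v hv
    have hv' : (0 : ℝ) < ‖v‖ ^ 2 := by positivity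
    refine ⟨fun a b => ?_, fun c a => ?_, fun a ha => ?_, ?_⟩
    · simp only [map_add, _root_.add_apply, inner_add_right, mul_add]
    · simp only [map_smul, _root_.smul_apply, inner_smul_right]
      ring
    · exact mul_nonneg (by exact_mod_cast (inv_nonneg.2 hv'.le)) (hpos v a ha)
    · simp only [hone, one_apply_eq_self]
      rw [inner_self_eq_norm_sq_to_K]
      have : ((‖v‖ ^ 2 : ℝ) : ℂ) ≠ 0 := by exact_mod_cast hv'.ne'
      push_cast at this ⊢
      exact inv_mul_cancel₀ this
  have hnorm : ‖ξ‖ ^ 2 + ‖η‖ ^ 2 = 1 := by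
    have h1 := hsum 1
    simp only [hone, one_apply_eq_self, inner_self_eq_norm_sq_to_K] at h1
    rw [hf.1.2.2.2] at h1
    rw [← Complex.ofReal_inj]
    push_cast
    exact h1.symm
  have hs : (0 : ℝ) < ‖ξ‖ ^ 2 := by positivity
  have ht : (0 : ℝ) < ‖η‖ ^ 2 := by positivity
  have hseg := hf.2 (hmem ξ hξ0) (hmem η hη0) ⟨_, _, hs, ht, hnorm, by
    ext a
    have h1 : ((‖ξ‖ ^ 2 : ℝ) : ℂ) ≠ 0 := by exact_mod_cast hs.ne'
    have h2 : ((‖η‖ ^ 2 : ℝ) : ℂ) ≠ 0 := by exact_mod_cast ht.ne'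
    rw [hsum a]
    simp only [Pi.add_apply, Pi.smul_apply, Complex.real_smul, Complex.ofReal_inv]
    rw [mul_inv_cancel_left₀ h1, mul_inv_cancel_left₀ h2]⟩
  -- The difference is orthogonal to the dense orbit of `Ω`.
  have hkey : ξ - ((‖ξ‖ ^ 2 : ℝ) : ℂ) • Ω = 0 := by
    have h1 : (ℂ ∙ (ξ - ((‖ξ‖ ^ 2 : ℝ) : ℂ) • Ω))ᗮ = ⊤ := by
      refine hdense _ (Submodule.isClosed_orthogonal _) fun a => ?_
      rw [Submodule.mem_orthogonal_singleton_iff_inner_right, inner_sub_left, inner_smul_left,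
        ← hfΩ, ← congrFun hseg a, Complex.conj_ofReal, Complex.ofReal_inv,
        mul_inv_cancel_left₀ (by exact_mod_cast hs.ne'), hΩ, map_add, inner_add_right,
        hKo a η hη ξ hξ, add_zero, sub_self]
    rw [Submodule.orthogonal_eq_top_iff, Submodule.span_singleton_eq_bot] at h1
    exact h1
  have hΩK : Ω ∈ K := by
    have h1 : Ω = (((‖ξ‖ ^ 2 : ℝ) : ℂ))⁻¹ • ξ := by
      rw [eq_inv_smul_iff₀ (by exact_mod_cast hs.ne')]
      exact (sub_eq_zero.1 hkey).symm
    rw [h1]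
    exact K.smul_mem _ hξ
  exact hdense K hKc fun a => hK a _ hΩK

theorem exists_isIrreducible_of_unital {x : B} (hx0 : x ≠ 0) :
    ∃ (H : Type u) (_ : NormedAddCommGroup H) (_ : InnerProductSpace ℂ H) (_ : CompleteSpace H)
      (π : B →⋆ₐ[ℂ] (H →L[ℂ] H)), IsIrreducible (π : B →⋆ₙₐ[ℂ] (H →L[ℂ] H)) ∧ π x ≠ 0 := by
  obtain ⟨f, hf, hfx⟩ := exists_extreme_state (star_mul_self_nonneg x)
    (by simpa using hx0)
  refine ⟨(states.toPositive hf.1).GNS, inferInstance, inferInstance, inferInstance,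
    (states.toPositive hf.1).gnsStarAlgHom, fun K hK h => isIrreducible_gns hf K hK h, fun h => hfx ?_⟩
  set F := states.toPositive hf.1 with hF
  have h1 : F.gnsNonUnitalStarAlgHom (star x * x) = 0 := by
    have h2 : F.gnsNonUnitalStarAlgHom x = 0 := h
    rw [map_mul, h2, mul_zero]
  have h3 : ⟪((F.toPreGNS 1 : F.PreGNS) : F.GNS), F.gnsNonUnitalStarAlgHom (star x * x)
      (F.toPreGNS 1 : F.PreGNS)⟫_ℂ = f (star x * x) := by
    rw [PositiveLinearMap.gnsNonUnitalStarAlgHom_apply_coe, UniformSpace.Completion.inner_coe,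
      PositiveLinearMap.preGNS_inner_def]
    simp only [PositiveLinearMap.leftMulMapPreGNS_apply, PositiveLinearMap.ofPreGNS_toPreGNS,
      star_one, one_mul, mul_one]
    simp [hF, states.toPositive_apply]
  rw [← h3, h1]
  simp

end States

/-- The irreducible representations of a C*-algebra separate its points. -/
theorem exists_isIrreducible {A : Type u} [NonUnitalCStarAlgebra A] {x : A} (hx : x ≠ 0) :
    ∃ (H : Type u) (_ : NormedAddCommGroup H) (_ : InnerProductSpace ℂ H) (_ : CompleteSpace H)
      (π : A →⋆ₙₐ[ℂ] (H →L[ℂ] H)), IsIrreducible π ∧ π x ≠ 0 := by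
  let _ := CStarAlgebra.spectralOrder (Unitization ℂ A)
  let _ := CStarAlgebra.spectralOrderedRing (Unitization ℂ A)
  have hx' : (x : Unitization ℂ A) ≠ 0 := fun h =>
    hx (Unitization.inr_injective (R := ℂ) (h.trans (Unitization.inr_zero ℂ).symm))
  obtain ⟨H, _, _, _, π, hπ, hπx⟩ := exists_isIrreducible_of_unital hx'
  -- Scalars preserve every subspace, so restricting from the unitization to `A` keeps
  -- irreducibility.
  refine ⟨H, inferInstance, inferInstance, inferInstance,
    (π : Unitization ℂ A →⋆ₙₐ[ℂ] (H →L[ℂ] H)).comp (Unitization.inrNonUnitalStarAlgHom ℂ A),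
    fun K hK hinv => hπ K hK fun a v hv => ?_, hπx⟩
  induction a using Unitization.ind with
  | inl_add_inr r a =>
    rw [map_add, _root_.add_apply]
    refine K.add_mem ?_ (hinv a v hv)
    change π (algebraMap ℂ (Unitization ℂ A) r) v ∈ K
    rw [AlgHomClass.commutes]
    exact K.smul_mem r hv

/-! ### Finite-dimensional representations and Burnside's theorem -/

section FiniteDimensional

variable {A : Type*} [NonUnitalCStarAlgebra A]
variable {H : Type*} [NormedAddCommGroup H] [InnerProductSpace ℂ H] [CompleteSpace H]

theorem IsIrreducible.conjStarAlgEquiv {H' : Type*} [NormedAddCommGroup H']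
    [InnerProductSpace ℂ H'] [CompleteSpace H'] {π : A →⋆ₙₐ[ℂ] (H →L[ℂ] H)} (hπ : IsIrreducible π)
    (e : H ≃ₗᵢ[ℂ] H') :
    IsIrreducible ((e.conjStarAlgEquiv : (H →L[ℂ] H) →⋆ₙₐ[ℂ] (H' →L[ℂ] H')).comp π) := by
  intro K hK hinv
  have h1 := hπ (K.comap (e.toLinearEquiv : H →ₗ[ℂ] H')) (hK.preimage e.continuous)
    fun a x hx => by
      have h2 : e (π a (e.symm (e x))) ∈ K := hinv a (e x) hx
      rwa [e.symm_apply_apply] at h2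
  refine h1.imp (fun h => ?_) fun h => ?_
  · rw [Submodule.eq_bot_iff] at h ⊢
    intro y hy
    have h3 := h (e.symm y) (by
      change e (e.symm y) ∈ K
      rwa [e.apply_symm_apply])
    rw [← e.apply_symm_apply y, h3, map_zero]
  · rw [Submodule.eq_top_iff'] at h ⊢
    intro y
    have h3 : e (e.symm y) ∈ K := h (e.symm y)
    rwa [e.apply_symm_apply] at h3

theorem conjStarAlgEquiv_comp_ne_zero {H' : Type*} [NormedAddCommGroup H']
    [InnerProductSpace ℂ H'] [CompleteSpace H'] {π : A →⋆ₙₐ[ℂ] (H →L[ℂ] H)} {a : A} (hπ : π a ≠ 0)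
    (e : H ≃ₗᵢ[ℂ] H') :
    (e.conjStarAlgEquiv : (H →L[ℂ] H) →⋆ₙₐ[ℂ] (H' →L[ℂ] H')).comp π ≠ 0 := by
  intro h
  apply hπ
  apply EquivLike.injective e.conjStarAlgEquiv
  exact (DFunLike.congr_fun h a).trans (map_zero e.conjStarAlgEquiv).symm

/-- The restriction of a representation to an invariant subspace. -/
def restrictRep (π : A →⋆ₙₐ[ℂ] (H →L[ℂ] H)) (K : Submodule ℂ H) [CompleteSpace K]
    (hK : ∀ a, ∀ x ∈ K, π a x ∈ K) : A →⋆ₙₐ[ℂ] (K →L[ℂ] K) where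
  toFun a := ((π a) ∘L K.subtypeL).codRestrict K fun x => hK a x x.2
  map_smul' c a := by ext x; exact congrArg (fun T : H →L[ℂ] H => T x) (map_smul π c a)
  map_zero' := by ext x; simp
  map_add' a b := by ext x; exact congrArg (fun T : H →L[ℂ] H => T x) (map_add π a b)
  map_mul' a b := by ext x; exact congrArg (fun T : H →L[ℂ] H => T x) (map_mul π a b)
  map_star' a := by
    rw [ContinuousLinearMap.star_eq_adjoint, ContinuousLinearMap.eq_adjoint_iff]
    intro x y
    change inner ℂ (π (star a) x) (y : H) = inner ℂ (x : H) (π a y)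
    rw [map_star, ContinuousLinearMap.star_eq_adjoint, ContinuousLinearMap.adjoint_inner_left]

theorem restrictRep_apply (π : A →⋆ₙₐ[ℂ] (H →L[ℂ] H)) (K : Submodule ℂ H) [CompleteSpace K]
    (hK : ∀ a, ∀ x ∈ K, π a x ∈ K) (a : A) (x : K) : (restrictRep π K hK a x : H) = π a x := rfl

/-- A nonzero finite-dimensional representation has a nonzero irreducible subrepresentation. -/
theorem exists_isIrreducible_restrictRep [FiniteDimensional ℂ H] (π : A →⋆ₙₐ[ℂ] (H →L[ℂ] H))
    (h0 : π ≠ 0) : ∃ (K : Submodule ℂ H) (_ : CompleteSpace K)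
      (hK : ∀ a, ∀ x ∈ K, π a x ∈ K),
      (∃ a, restrictRep π K hK a ≠ 0) ∧ IsIrreducible (restrictRep π K hK) := by
  -- Only subspaces on which `π` is nonzero compete: a minimal nonzero invariant subspace could
  -- carry the zero representation.
  obtain ⟨K, hK⟩ := exists_minimal_of_wellFoundedLT
    (fun K : Submodule ℂ H => (∀ a, ∀ x ∈ K, π a x ∈ K) ∧ ∃ a, ∃ x ∈ K, π a x ≠ 0)
    ⟨⊤, fun _ _ _ => trivial, by
      by_contra! h1
      exact h0 (by ext a x; exact h1 a x trivial)⟩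
  obtain ⟨⟨hinv, a, x, hx, hax⟩, hmin⟩ := hK
  have : CompleteSpace K := FiniteDimensional.complete ℂ K
  refine ⟨K, this, hinv, ⟨a, fun h => hax ?_⟩, fun L _ hL => ?_⟩
  · rw [← restrictRep_apply π K hinv a ⟨x, hx⟩, h]; rfl
  by_cases hL0 : L = ⊥
  · exact Or.inl hL0
  right
  have hL' : ∀ a, ∀ x ∈ L.map K.subtype, π a x ∈ L.map K.subtype := by
    rintro a _ ⟨x, hx, rfl⟩
    exact ⟨_, hL a x hx, rfl⟩
  have hLK : L.map K.subtype ≤ K := Submodule.map_subtype_le K L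
  suffices h : K ≤ L.map K.subtype by
    rw [Submodule.eq_top_iff']
    intro y
    obtain ⟨z, hz, hzy⟩ := h y.2
    rwa [← Subtype.ext hzy]
  refine hmin ⟨hL', ?_⟩ hLK
  by_contra! h1
  -- If `π` vanishes on `L`, minimality of `K` makes it vanish on the complement `M` as well, hence
  -- on all of `K`.
  set M := K ⊓ (L.map K.subtype)ᗮ with hM
  have hMinv : ∀ a, ∀ x ∈ M, π a x ∈ M := fun a x hx => ⟨hinv a x hx.1, fun w hw => by
    rw [← ContinuousLinearMap.adjoint_inner_left, ← ContinuousLinearMap.star_eq_adjoint, ← map_star]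
    exact hx.2 _ (hL' _ _ hw)⟩
  have h2 : ∀ a, ∀ x ∈ M, π a x = 0 := by
    by_contra! h3
    have hKM : K ≤ M := hmin ⟨hMinv, h3⟩ inf_le_left
    obtain ⟨y, hy, hy0⟩ := Submodule.exists_mem_ne_zero_of_ne_bot hL0
    have hy' : (y : H) ∈ L.map K.subtype := ⟨y, hy, rfl⟩
    exact hy0 (Subtype.ext (inner_self_eq_zero.1 ((hKM y.2).2 _ hy')))
  apply hax
  have h3 : x = (L.map K.subtype).starProjection x + (x - (L.map K.subtype).starProjection x) := by
    simp
  have h4 := (L.map K.subtype).starProjection_apply_mem x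
  rw [h3, map_add, h1 _ _ h4, h2 _ _ ⟨K.sub_mem hx (hLK h4),
    (L.map K.subtype).sub_starProjection_mem_orthogonal x⟩, add_zero]

/-- Burnside's theorem for representations by matrices. -/
theorem surjective_of_forall_submodule {n : ℕ} (ρ : A →⋆ₙₐ[ℂ] Mat n) (h0 : ρ ≠ 0)
    (hρ : ∀ K : Submodule ℂ (Fin n → ℂ), (∀ a, ∀ v ∈ K, (ρ a).mulVec v ∈ K) → K = ⊥ ∨ K = ⊤) :
    Function.Surjective ρ := by
  have : IsScalarTower ℂ (Mat n) (Fin n → ℂ) := ⟨fun c M v => Matrix.smul_mulVec c M v⟩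
  -- Since `A` need not have a unit, the density theorem is applied after adjoining scalars; the
  -- range of `ρ` is an ideal in `S`.
  let S : Subalgebra ℂ (Mat n) := Algebra.adjoin ℂ (Set.range ρ)
  have hS : ∀ T ∈ S, ∃ (c : ℂ) (a : A), T = c • (1 : Mat n) + ρ a := by
    intro T hT
    induction hT using Algebra.adjoin_induction with
    | mem T hT =>
      obtain ⟨a, rfl⟩ := hT
      exact ⟨0, a, by simp⟩
    | algebraMap r => exact ⟨r, 0, by simp [Algebra.algebraMap_eq_smul_one]⟩
    | add T T' _ _ h h' =>
      obtain ⟨c, a, rfl⟩ := h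
      obtain ⟨c', a', rfl⟩ := h'
      exact ⟨c + c', a + a', by rw [add_smul, map_add]; abel⟩
    | mul T T' _ _ h h' =>
      obtain ⟨c, a, rfl⟩ := h
      obtain ⟨c', a', rfl⟩ := h'
      refine ⟨c * c', c • a' + c' • a + a * a', ?_⟩
      simp only [map_add, map_smul, map_mul, add_mul, mul_add, smul_mul_assoc, mul_smul_comm,
        one_mul, mul_one, smul_add, mul_smul]
      rw [smul_comm]
      abel
  obtain ⟨c, hc⟩ : ∃ c, ρ c ≠ 0 := by
    by_contra! h
    exact h0 (by ext1 a; exact h a)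
  obtain ⟨i, j, hij⟩ : ∃ i j, ρ c i j ≠ 0 := by
    by_contra! h
    exact hc (by ext i j; exact h i j)
  have hnt : Nontrivial (Fin n → ℂ) := ⟨Pi.single i 1, 0, by simp⟩
  have hsimple : IsSimpleModule S (Fin n → ℂ) := by
    refine (isSimpleModule_iff _ _).2 (@IsSimpleOrder.mk _ _ _ inferInstance fun N => ?_)
    refine (hρ (N.restrictScalars ℂ) fun a v hv => ?_).imp (fun h => ?_) fun h => ?_
    · exact N.smul_mem ⟨ρ a, Algebra.subset_adjoin ⟨a, rfl⟩⟩ hv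
    · simpa using h
    · simpa using h
  have hSchur := (IsSimpleModule.algebraMap_end_bijective_of_isAlgClosed (A := S)
    (V := Fin n → ℂ) ℂ).2
  have htop : ∀ T : Mat n, T ∈ S := by
    intro T
    -- By Schur's lemma the commutant of `S` is scalar, so every matrix lies in the double commutant
    -- and density on a basis puts it in `S`.
    let F : Module.End (Module.End S (Fin n → ℂ)) (Fin n → ℂ) :=
      { toFun := fun v => T.mulVec v
        map_add' := T.mulVec_add
        map_smul' := fun e v => by
          obtain ⟨z, rfl⟩ := hSchur e
          exact T.mulVec_smul z v }
    obtain ⟨r, hr⟩ := jacobson_density F (Finset.univ.image fun k => Pi.single k (1 : ℂ))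
    have hTr : T = r := by
      refine Matrix.ext_of_mulVec_single fun k => ?_
      exact hr _ (Finset.mem_image_of_mem _ (Finset.mem_univ k))
    exact hTr ▸ r.2
  have hideal : ∀ X Y : Mat n, ∃ a, ρ a = X * ρ c * Y := by
    intro X Y
    obtain ⟨x, a, rfl⟩ := hS X (htop X)
    obtain ⟨y, b, rfl⟩ := hS Y (htop Y)
    refine ⟨(x * y) • c + y • (a * c) + x • (c * b) + a * c * b, ?_⟩
    simp only [map_add, map_smul, map_mul, add_mul, mul_add, smul_mul_assoc, mul_smul_comm,
      one_mul, mul_one, smul_add, mul_smul]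
    rw [smul_comm]
    abel
  choose f hf using hideal
  have hone : ρ ((ρ c i j)⁻¹ • ∑ k, f (Matrix.single k i 1) (Matrix.single j k 1)) = 1 := by
    rw [map_smul, map_sum]
    simp only [hf]
    rw [sum_single_mul_single, inv_smul_smul₀ hij]
  intro T
  obtain ⟨x, a, rfl⟩ := hS T (htop T)
  exact ⟨x • ((ρ c i j)⁻¹ • ∑ k, f (Matrix.single k i 1) (Matrix.single j k 1)) + a, by
    rw [map_add, map_smul, hone]⟩

end FiniteDimensional

/-! ### Representations of homogeneous algebras -/

section Homogeneous

variable {A : Type u} [NonUnitalCStarAlgebra A] {n : ℕ}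

/-- Frees the definition from its universe: an orthonormal basis moves a finite-dimensional `H` to a
Euclidean space in the universe of `A`. -/
theorem IsHomogeneous.finrank_eq (hA : IsHomogeneous n A) {H : Type*} [NormedAddCommGroup H]
    [InnerProductSpace ℂ H] [CompleteSpace H] [FiniteDimensional ℂ H]
    (π : A →⋆ₙₐ[ℂ] (H →L[ℂ] H)) {a : A} (h0 : π a ≠ 0) (hπ : IsIrreducible π) :
    Module.finrank ℂ H = n := by
  let b : OrthonormalBasis (ULift.{u} (Fin (Module.finrank ℂ H))) ℂ H :=
    (stdOrthonormalBasis ℂ H).reindex Equiv.ulift.symm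
  have h1 := (hA (EuclideanSpace ℂ (ULift.{u} (Fin (Module.finrank ℂ H)))) _
    (conjStarAlgEquiv_comp_ne_zero h0 b.repr) (hπ.conjStarAlgEquiv b.repr)).2
  simpa using h1

/-- Its irreducible nonzero subrepresentation already has dimension `n`, hence is everything. -/
theorem IsHomogeneous.isIrreducible (hA : IsHomogeneous n A) {H : Type*} [NormedAddCommGroup H]
    [InnerProductSpace ℂ H] [CompleteSpace H] [FiniteDimensional ℂ H] (hn : Module.finrank ℂ H = n)
    (π : A →⋆ₙₐ[ℂ] (H →L[ℂ] H)) (h0 : π ≠ 0) : IsIrreducible π := by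
  obtain ⟨K, _, hK, ⟨a, hK0⟩, hirr⟩ := exists_isIrreducible_restrictRep π h0
  have hKtop : K = ⊤ :=
    Submodule.eq_top_of_finrank_eq ((hA.finrank_eq _ hK0 hirr).trans hn.symm)
  intro L hL hinv
  refine (hirr (L.comap K.subtype) (hL.preimage continuous_subtype_val)
    fun a x hx => hinv a x hx).imp (fun h => ?_) fun h => ?_
  · rw [Submodule.eq_bot_iff] at h ⊢
    intro x hx
    exact congrArg Subtype.val (h ⟨x, hKtop ▸ trivial⟩ hx)
  · rw [Submodule.eq_top_iff'] at h ⊢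
    exact fun x => h ⟨x, hKtop ▸ trivial⟩

theorem IsHomogeneous.surjective (hA : IsHomogeneous n A) (ρ : A →⋆ₙₐ[ℂ] Mat n) (h0 : ρ ≠ 0) :
    Function.Surjective ρ := by
  refine surjective_of_forall_submodule ρ h0 fun K hK => ?_
  let E := Matrix.toEuclideanCLM (n := Fin n) (𝕜 := ℂ)
  have hE0 :
      (E : Mat n →⋆ₙₐ[ℂ] (EuclideanSpace ℂ (Fin n) →L[ℂ] EuclideanSpace ℂ (Fin n))).comp ρ ≠ 0 := by
    intro h
    apply h0
    ext1 a
    apply EquivLike.injective E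
    exact (DFunLike.congr_fun h a).trans (map_zero E).symm
  have h1 := hA.isIrreducible (by simp) _ hE0
    (K.comap (WithLp.linearEquiv 2 ℂ (Fin n → ℂ) : EuclideanSpace ℂ (Fin n) →ₗ[ℂ] (Fin n → ℂ)))
    (Submodule.closed_of_finiteDimensional _) fun a x hx => hK a _ hx
  refine h1.imp (fun h => ?_) fun h => ?_
  · rw [Submodule.eq_bot_iff] at h ⊢
    intro x hx
    exact congrArg WithLp.ofLp (h (WithLp.toLp 2 x) hx)
  · rw [Submodule.eq_top_iff'] at h ⊢
    exact fun x => h (WithLp.toLp 2 x)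

theorem IsHomogeneous.exists_ne_zero (hA : IsHomogeneous n A) {a : A} (ha : a ≠ 0) :
    ∃ ρ : A →⋆ₙₐ[ℂ] Mat n, ρ a ≠ 0 := by
  obtain ⟨H, _, _, _, π, hπ, hπa⟩ := exists_isIrreducible ha
  obtain ⟨hfd, hn⟩ := hA H π (fun h => hπa (DFunLike.congr_fun h a)) hπ
  let E := Matrix.toEuclideanCLM (n := Fin n) (𝕜 := ℂ)
  let b : OrthonormalBasis (Fin n) ℂ H := (stdOrthonormalBasis ℂ H).reindex (finCongr hn)
  let F := b.repr.conjStarAlgEquiv.trans E.symm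
  refine ⟨(F : (H →L[ℂ] H) →⋆ₙₐ[ℂ] Mat n).comp π, fun h => hπa ?_⟩
  apply EquivLike.injective F
  exact h.trans (map_zero F).symm

end Homogeneous

/-! ### Evaluations on the algebra of an `n`-space -/

namespace NSpace

variable {n : ℕ}

/-- Evaluation at a point of an `n`-space. -/
def eval (X : NSpace.{u} n) (x : X) : X.cstar →⋆ₙₐ[ℂ] Mat n where
  toFun f := f.1 x
  map_smul' _ _ := rfl
  map_zero' := rfl
  map_add' _ _ := rfl
  map_mul' _ _ := rfl
  map_star' _ := rfl

theorem eval_smul (X : NSpace.{u} n) (g : PU n) (x : X) (f : X.cstar) :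
    X.eval (g • x) f = conj n g (X.eval x f) := f.2 g x

theorem continuous_eval (X : NSpace.{u} n) (f : X.cstar) : Continuous fun x => X.eval x f :=
  f.1.continuous

theorem isCompact_le_norm (X : NSpace.{u} n) (f : X.cstar) {ε : ℝ} (hε : 0 < ε) :
    IsCompact {x | ε ≤ ‖X.eval x f‖} := by
  have h1 : ∀ᶠ x in Filter.cocompact X, ‖X.eval x f‖ < ε := by
    have := (zero_at_infty f.1).norm
    rw [norm_zero] at this
    exact this.eventually_lt_const hε
  obtain ⟨K, hK, hKs⟩ := Filter.mem_cocompact.1 h1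
  refine hK.of_isClosed_subset (isClosed_le continuous_const (X.continuous_eval f).norm) ?_
  intro x hx
  by_contra hxK
  exact (not_lt.2 hx) (show ‖X.eval x f‖ < ε from hKs hxK)

end NSpace

/-! ### The spectrum as an `n`-space and the Gelfand map -/

section Spec

variable (n : ℕ) (A : Type u) [NonUnitalCStarAlgebra A]

/-- The `*`-homomorphisms `A → M_n`, as a set of functions. -/
def homs : Set (A → Mat n) := Set.range fun ρ : A →⋆ₙₐ[ℂ] Mat n => ⇑ρ

/-- Homomorphisms are contractive and cut out by closed pointwise identities. The zero homomorphism
must be included here; removing it leaves an open subset. -/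
theorem isCompact_homs : IsCompact (homs n A) := by
  have hc : IsCompact (Set.univ.pi fun a : A => Metric.closedBall (0 : Mat n) ‖a‖) :=
    isCompact_univ_pi fun a => isCompact_closedBall _ _
  have heq : homs n A = {f | (∀ (c : ℂ) (a), f (c • a) = c • f a) ∧ (∀ a b, f (a + b) = f a + f b) ∧
      (∀ a b, f (a * b) = f a * f b) ∧ (∀ a, f (star a) = star (f a))} := by
    ext f
    constructor
    · rintro ⟨ρ, rfl⟩
      exact ⟨map_smul ρ, map_add ρ, map_mul ρ, map_star ρ⟩
    · rintro ⟨h1, h2, h3, h4⟩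
      exact ⟨⟨⟨⟨⟨f, h1⟩, by simpa using h1 0 0, h2⟩, h3⟩, h4⟩, rfl⟩
  refine hc.of_isClosed_subset ?_ ?_
  · rw [heq]
    simp only [Set.ofPred_and, Set.ofPred_forall]
    refine (isClosed_iInter fun c => isClosed_iInter fun a => isClosed_eq ?_ ?_).inter
      ((isClosed_iInter fun c => isClosed_iInter fun a => isClosed_eq ?_ ?_).inter
      ((isClosed_iInter fun c => isClosed_iInter fun a => isClosed_eq ?_ ?_).inter
      (isClosed_iInter fun a => isClosed_eq ?_ ?_))) <;> fun_prop
  · rintro _ ⟨ρ, rfl⟩ a _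
    simpa using NonUnitalStarAlgHom.norm_apply_le ρ a

/-- The space of nonzero `*`-homomorphisms `A → M_n`, with the topology of pointwise
convergence. -/
abbrev Spec : Type u := {f : homs n A // (f : A → Mat n) ≠ 0}

instance : LocallyCompactSpace (Spec n A) := by
  have := isCompact_iff_compactSpace.1 (isCompact_homs n A)
  refine IsOpen.locallyCompactSpace (X := homs n A) ?_
  exact isOpen_ne_fun continuous_subtype_val continuous_const

variable {n A}

namespace Spec

/-- A point of the spectrum as a `*`-homomorphism. -/
def hom (x : Spec n A) : A →⋆ₙₐ[ℂ] Mat n := x.1.2.choose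

theorem coe_hom (x : Spec n A) : ⇑x.hom = x.1.1 := x.1.2.choose_spec

theorem hom_ne_zero (x : Spec n A) : x.hom ≠ 0 := fun h => x.2 (by rw [← coe_hom, h]; rfl)

theorem ext {x y : Spec n A} (h : ∀ a, x.hom a = y.hom a) : x = y := by
  apply Subtype.ext
  apply Subtype.ext
  rw [← coe_hom, ← coe_hom]
  exact funext h

/-- A nonzero `*`-homomorphism as a point of the spectrum. -/
def ofHom (ρ : A →⋆ₙₐ[ℂ] Mat n) (h : ∃ a, ρ a ≠ 0) : Spec n A :=
  ⟨⟨ρ, ρ, rfl⟩, fun h0 => h.choose_spec (congrFun h0 _)⟩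

theorem ofHom_hom (ρ : A →⋆ₙₐ[ℂ] Mat n) (h : ∃ a, ρ a ≠ 0) (a : A) : (ofHom ρ h).hom a = ρ a :=
  congrFun (coe_hom (ofHom ρ h)) a

theorem exists_hom_ne_zero (x : Spec n A) : ∃ a, x.hom a ≠ 0 := by
  by_contra! h
  exact x.hom_ne_zero (by ext1 a; exact h a)

theorem continuous_hom_apply (a : A) : Continuous fun x : Spec n A => x.hom a := by
  simp only [coe_hom]
  exact (continuous_apply a).comp (continuous_subtype_val.comp continuous_subtype_val)

theorem continuous_of_forall {Y : Type*} [TopologicalSpace Y] {f : Y → Spec n A}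
    (h : ∀ a, Continuous fun y => (f y).hom a) : Continuous f := by
  simp only [coe_hom] at h
  exact (continuous_pi h).subtype_mk _ |>.subtype_mk _

instance : MulAction (PU n) (Spec n A) where
  smul g x := ofHom ((conj n g : Mat n →⋆ₙₐ[ℂ] Mat n).comp x.hom) (by
    obtain ⟨a, ha⟩ := x.exists_hom_ne_zero
    exact ⟨a, (map_ne_zero_iff _ (conj n g).injective).2 ha⟩)
  one_smul x := ext fun a => (ofHom_hom _ _ a).trans (by
    change conj n 1 (x.hom a) = _
    rw [map_one]; rfl)
  mul_smul g h x := ext fun a => (ofHom_hom _ _ a).trans (by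
    refine Eq.trans ?_ (ofHom_hom _ _ a).symm
    change conj n (g * h) (x.hom a) = conj n g ((ofHom _ _).hom a)
    rw [ofHom_hom, ← conj_conj]; rfl)

theorem smul_hom (g : PU n) (x : Spec n A) (a : A) : (g • x).hom a = conj n g (x.hom a) :=
  ofHom_hom _ _ a

instance : ContinuousSMul (PU n) (Spec n A) where
  continuous_smul := continuous_of_forall fun a => by
    simp only [smul_hom]
    exact continuous_conj.comp
      (continuous_fst.prodMk ((continuous_hom_apply a).comp continuous_snd))

theorem isCompact_le_norm (a : A) {ε : ℝ} (hε : 0 < ε) :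
    IsCompact {x : Spec n A | ε ≤ ‖x.hom a‖} := by
  have hcs := isCompact_iff_compactSpace.1 (isCompact_homs n A)
  rw [Topology.IsEmbedding.subtypeVal.isCompact_iff]
  have : Subtype.val '' {x : Spec n A | ε ≤ ‖x.hom a‖} = {f : homs n A | ε ≤ ‖f.1 a‖} := by
    ext f
    constructor
    · rintro ⟨x, hx, rfl⟩
      change ε ≤ ‖hom x a‖ at hx
      rwa [coe_hom] at hx
    · intro hf
      refine ⟨⟨f, fun h0 => ?_⟩, ?_, rfl⟩
      · change ε ≤ ‖f.1 a‖ at hf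
        rw [h0] at hf
        simp only [Pi.zero_apply, norm_zero] at hf
        exact absurd hf (not_le.2 hε)
      · change ε ≤ ‖(Spec.hom _) a‖
        rwa [coe_hom]
  rw [this]
  exact (isClosed_le continuous_const
    ((continuous_apply a).comp continuous_subtype_val).norm).isCompact

end Spec

/-- The `n`-space of nonzero `*`-homomorphisms from an `n`-homogeneous C*-algebra to `M_n`. -/
def IsHomogeneous.nspace (hA : IsHomogeneous n A) : NSpace.{max u v} n :=
  -- The lift only allows the space to live in a larger universe.
  { carrier := ULift.{v} (Spec n A)
    t2 := Homeomorph.ulift.isEmbedding.t2Space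
    locallyCompact := Homeomorph.ulift.isClosedEmbedding.locallyCompactSpace
    continuous_action := ⟨continuous_uliftUp.comp (continuous_smul.comp
      (continuous_fst.prodMk (continuous_uliftDown.comp continuous_snd)))⟩
    free := fun g x hx => eq_one_of_conj_eq g fun T => by
      obtain ⟨a, rfl⟩ := hA.surjective x.down.hom x.down.hom_ne_zero T
      rw [← Spec.smul_hom]
      exact congrArg (fun y => y.down.hom a) hx }

/-- The canonical map of an `n`-homogeneous C*-algebra to the algebra of its `n`-space. -/
def IsHomogeneous.gelfand (hA : IsHomogeneous n A) :
    A →⋆ₙₐ[ℂ] (IsHomogeneous.nspace.{u, v} hA).cstar where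
  toFun a := ⟨⟨⟨fun x : ULift (Spec n A) => x.down.hom a,
      (Spec.continuous_hom_apply a).comp continuous_uliftDown⟩, by
      rw [Metric.tendsto_nhds]
      intro ε hε
      refine Filter.mem_cocompact.2 ⟨_, Homeomorph.ulift.isClosedEmbedding.isCompact_preimage
        (Spec.isCompact_le_norm a hε), fun x hx => ?_⟩
      change dist (x.down.hom a) 0 < ε
      rw [dist_zero_right]
      exact not_le.1 hx⟩, fun g x => Spec.smul_hom g x.down a⟩
  map_smul' c a := Subtype.ext (ZeroAtInftyContinuousMap.ext fun x => map_smul x.down.hom c a)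
  map_zero' := Subtype.ext (ZeroAtInftyContinuousMap.ext fun x => map_zero x.down.hom)
  map_add' a b := Subtype.ext (ZeroAtInftyContinuousMap.ext fun x => map_add x.down.hom a b)
  map_mul' a b := Subtype.ext (ZeroAtInftyContinuousMap.ext fun x => map_mul x.down.hom a b)
  map_star' a := Subtype.ext (ZeroAtInftyContinuousMap.ext fun x => map_star x.down.hom a)

theorem IsHomogeneous.eval_gelfand (hA : IsHomogeneous n A)
    (x : IsHomogeneous.nspace.{u, v} hA) (a : A) :
    (IsHomogeneous.nspace.{u, v} hA).eval x (hA.gelfand a) = x.down.hom a := rfl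

theorem IsHomogeneous.gelfand_injective (hA : IsHomogeneous n A) :
    Function.Injective (IsHomogeneous.gelfand.{u, v} hA) := by
  rw [injective_iff_map_eq_zero]
  intro a ha
  by_contra h0
  obtain ⟨ρ, hρ⟩ := hA.exists_ne_zero h0
  apply hρ
  rw [← Spec.ofHom_hom ρ ⟨a, hρ⟩, ← hA.eval_gelfand ⟨Spec.ofHom ρ ⟨a, hρ⟩⟩ a, ha, map_zero]

end Spec

/-! ### Functional calculus with explicit cutoff functions -/

section FunctionalCalculus

variable {A D : Type*} [NonUnitalCStarAlgebra A] [CStarAlgebra D]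

/-- Passes from the non-unital calculus in `A` to the unital one in the matrices, so that elements
of `A` can be modified point by point. -/
theorem map_cfcₙ_eq_cfc (θ : A →⋆ₙₐ[ℂ] D) {h : ℝ → ℝ} (hc : Continuous h) (h0 : h 0 = 0) {a : A}
    (ha : IsSelfAdjoint a) : θ (cfcₙ h a) = cfc h (θ a) := by
  rw [NonUnitalStarAlgHom.map_cfcₙ θ h a hc.continuousOn h0
    ((NonUnitalStarAlgHom.instContinuousLinearMapClassComplex (F := A →⋆ₙₐ[ℂ] D)).map_continuous θ)
    ha (ha.map θ)]
  exact cfcₙ_eq_cfc hc.continuousOn h0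

/-- A continuous function vanishing on `[-1/2, 1/2]` with value `1` at `1`. -/
def cut (t : ℝ) : ℝ := max 0 (2 * t - 1)

theorem continuous_cut : Continuous cut := by unfold cut; fun_prop

theorem cfc_cut_eq_zero {d : D} (hd : IsSelfAdjoint d) (h : ‖d‖ ≤ 1 / 2) : cfc cut d = 0 := by
  rw [← cfc_zero ℝ d]
  refine cfc_congr fun t ht => ?_
  have h1 := norm_apply_le_norm_cfc (fun t : ℝ => t) d ht
  rw [cfc_id' ℝ d, Real.norm_eq_abs] at h1
  have := le_abs_self t
  exact max_eq_left (by linarith)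

theorem cfc_cut_one : cfc cut (1 : D) = 1 := by
  rw [cfc_apply_one]
  norm_num [cut]

/-- A continuous function with value `0` on `(-∞, 1/4]` and `1` on `[3/4, ∞)`. -/
def step (t : ℝ) : ℝ := min 1 (max 0 (2 * t - 1 / 2))

theorem continuous_step : Continuous step := by unfold step; fun_prop

theorem step_of_le {t : ℝ} (h : t ≤ 1 / 4) : step t = 0 := by
  rw [step, max_eq_left (by linarith), min_eq_right (by norm_num)]

theorem step_of_ge {t : ℝ} (h : 3 / 4 ≤ t) : step t = 1 := by
  rw [step, max_eq_right (by linarith), min_eq_left (by linarith)]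

theorem abs_sq_sub_le {d : D} (hd : IsSelfAdjoint d) {t : ℝ} (ht : t ∈ spectrum ℝ d) :
    |t * t - t| ≤ ‖d * d - d‖ := by
  have h1 := norm_apply_le_norm_cfc (fun t : ℝ => t * t - t) d ht
  rwa [cfc_sub (fun t : ℝ => t * t) (fun t => t) d, cfc_mul (fun t : ℝ => t) (fun t => t) d,
    cfc_id' ℝ d, Real.norm_eq_abs] at h1

/-- As `t² - t = -3/16` exactly at `1/4` and `3/4`, the spectrum avoids the interval between them,
and off it `step` is 0 or 1. -/
theorem cfc_step_mul_self {d : D} (hd : IsSelfAdjoint d) (h : ‖d * d - d‖ < 3 / 16) :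
    cfc step d * cfc step d = cfc step d := by
  rw [← cfc_mul step step d continuous_step.continuousOn continuous_step.continuousOn]
  refine cfc_congr fun t ht => ?_
  have h1 := (abs_lt.1 ((abs_sq_sub_le hd ht).trans_lt h)).1
  rcases le_or_gt t (1 / 4) with h2 | h2
  · simp [step_of_le h2]
  · rw [step_of_ge (t := t) (by nlinarith), mul_one]

theorem cfc_step_of_isIdempotent {d : D} (hd : IsSelfAdjoint d) (h : d * d = d) :
    cfc step d = d := by
  conv_rhs => rw [← cfc_id' ℝ d]
  refine cfc_congr fun t ht => ?_
  have h1 := abs_sq_sub_le hd ht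
  rw [h, sub_self, norm_zero, abs_nonpos_iff] at h1
  have h2 : t * (t - 1) = 0 := by linarith
  rcases mul_eq_zero.1 h2 with h3 | h3
  · simp [h3, step]
  · rw [sub_eq_zero.1 h3, step_of_ge (by norm_num)]

/-- A continuous function vanishing at `0` with value `t⁻¹` at every `t ≥ 1/2`. -/
def approxInv (t : ℝ) : ℝ := t / max (t * t) (1 / 4)

theorem continuous_approxInv : Continuous approxInv := by
  unfold approxInv
  refine continuous_id.div (by fun_prop) fun t => ?_
  have : (1 / 4 : ℝ) ≤ max (t * t) (1 / 4) := le_max_right _ _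
  linarith

theorem mul_cfc_approxInv {d : D} (hd : IsSelfAdjoint d) (h : ‖d - 1‖ ≤ 1 / 2) :
    d * cfc approxInv d = 1 := by
  conv_lhs => enter [1]; rw [← cfc_id' ℝ d]
  rw [← cfc_mul (fun t : ℝ => t) approxInv d (by fun_prop) continuous_approxInv.continuousOn,
    ← cfc_one ℝ d]
  refine cfc_congr fun t ht => ?_
  have h1 := norm_apply_le_norm_cfc (fun t : ℝ => t - 1) d ht
  rw [cfc_sub (fun t : ℝ => t) (fun _ => 1) d, cfc_id' ℝ d, cfc_const_one ℝ d,
    Real.norm_eq_abs] at h1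
  have h2 := (abs_le.1 (h1.trans h)).1
  have h3 : 1 / 2 ≤ t := by linarith
  rw [approxInv, max_eq_left (by nlinarith)]
  have : t ≠ 0 := by linarith
  simp only [Pi.one_apply]
  field_simp

/-- A continuous function with value `0` at `0`, value `1` on `[1/2, ∞)`, and values in
`[0, 1]`. -/
def clamp (t : ℝ) : ℝ := max 0 (min 1 (2 * t))

theorem continuous_clamp : Continuous clamp := by unfold clamp; fun_prop

theorem clamp_nonneg (t : ℝ) : 0 ≤ clamp t := le_max_left _ _

theorem clamp_le_one (t : ℝ) : clamp t ≤ 1 := max_le zero_le_one (min_le_left _ _)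

theorem clamp_zero : clamp 0 = 0 := by simp [clamp]

theorem clamp_of_ge {t : ℝ} (h : 1 / 2 ≤ t) : clamp t = 1 := by
  rw [clamp, min_eq_left (by linarith), max_eq_right zero_le_one]

end FunctionalCalculus

theorem trace_eq_one_of_mul_self {n : ℕ} {p : Mat n} (hp : p * p = p) (h : ‖p.trace - 1‖ < 1) :
    p.trace = 1 := by
  have hid : IsIdempotentElem (Matrix.toLin' p) := by
    rw [IsIdempotentElem, Module.End.mul_eq_comp, ← Matrix.toLin'_mul, hp]
  have h1 := (LinearMap.IsIdempotentElem.isProj_range _ hid).trace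
  rw [Matrix.trace_toLin'_eq] at h1
  rw [h1] at h ⊢
  have h2 : ‖(((Module.finrank ℂ (LinearMap.range (Matrix.toLin' p)) : ℤ) - 1 : ℤ) : ℂ)‖ < 1 := by
    push_cast
    exact h
  rw [Complex.norm_intCast] at h2
  have h3 : |((Module.finrank ℂ (LinearMap.range (Matrix.toLin' p)) : ℤ) - 1 : ℤ)| < 1 := by
    exact_mod_cast h2
  rw [Int.abs_lt_one_iff] at h3
  have h4 : Module.finrank ℂ (LinearMap.range (Matrix.toLin' p)) = 1 := by omega
  rw [h4, Nat.cast_one]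

/-! ### A Stone–Weierstrass theorem for `n`-spaces -/

section StoneWeierstrass

variable {n : ℕ} {A : Type u} [NonUnitalCStarAlgebra A] {X : NSpace.{w} n}

/-- A `*`-homomorphism to the algebra of an `n`-space is rich if its compositions with the
evaluations are surjective and it separates the orbits. -/
structure IsRich (φ : A →⋆ₙₐ[ℂ] X.cstar) : Prop where
  surjective : ∀ x T, ∃ a, X.eval x (φ a) = T
  separates : ∀ x y : X, (∀ g : PU n, g • x ≠ y) → ∃ a, X.eval x (φ a) = 1 ∧ X.eval y (φ a) = 0

variable {φ : A →⋆ₙₐ[ℂ] X.cstar}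

theorem eval_cfcₙ (φ : A →⋆ₙₐ[ℂ] X.cstar) (x : X) {h : ℝ → ℝ} (hc : Continuous h) (h0 : h 0 = 0)
    {a : A} (ha : IsSelfAdjoint a) : X.eval x (φ (cfcₙ h a)) = cfc h (X.eval x (φ a)) :=
  map_cfcₙ_eq_cfc ((X.eval x).comp φ) hc h0 ha

theorem isSelfAdjoint_eval (φ : A →⋆ₙₐ[ℂ] X.cstar) (x : X) {a : A} (ha : IsSelfAdjoint a) :
    IsSelfAdjoint (X.eval x (φ a)) := (ha.map φ).map (X.eval x)

/-- Separating elements are made to vanish on open sets by `cut`, and finitely many of them are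
multiplied to cover a compact part of `K`. Off that part a cut-down `star b * b` vanishes. -/
theorem IsRich.exists_eq_one_of_isClosed (hφ : IsRich φ) (z : X) {K : Set X} (hK : IsClosed K)
    (hz : ∀ g : PU n, g • z ∉ K) :
    ∃ s, X.eval z (φ s) = 1 ∧ ∀ x ∈ K, X.eval x (φ s) = 0 := by
  have hcut : ∀ b, X.eval z (φ b) = 1 → X.eval z (φ (cfcₙ cut (star b * b))) = 1 := by
    intro b hb
    rw [eval_cfcₙ φ z continuous_cut (by norm_num [cut]) (.star_mul_self b)]
    simp only [map_mul, map_star, hb, star_one, one_mul, cfc_cut_one]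
  have hcut0 : ∀ b x, ‖X.eval x (φ (star b * b))‖ ≤ 1 / 2 →
      X.eval x (φ (cfcₙ cut (star b * b))) = 0 := by
    intro b x hx
    rw [eval_cfcₙ φ x continuous_cut (by norm_num [cut]) (.star_mul_self b)]
    exact cfc_cut_eq_zero (isSelfAdjoint_eval φ x (.star_mul_self b)) hx
  obtain ⟨b, hb⟩ := hφ.surjective z 1
  have hloc : ∃ s, X.eval z (φ s) = 1 ∧
      ∀ x ∈ K ∩ {x | 1 / 2 ≤ ‖X.eval x (φ (star b * b))‖}, X.eval x (φ s) = 0 := by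
    refine ((X.isCompact_le_norm (φ (star b * b)) (by norm_num)).inter_left hK).induction_on
      (p := fun S => ∃ s, X.eval z (φ s) = 1 ∧ ∀ x ∈ S, X.eval x (φ s) = 0)
      ⟨b, hb, by simp⟩ (fun s t hst ⟨c, hc, h⟩ => ⟨c, hc, fun x hx => h x (hst hx)⟩) ?_ ?_
    · rintro s t ⟨c, hc, h⟩ ⟨c', hc', h'⟩
      refine ⟨c * c', by rw [map_mul, map_mul, hc, hc', one_mul], ?_⟩
      rintro x (hx | hx)
      · rw [map_mul, map_mul, h x hx, zero_mul]
      · rw [map_mul, map_mul, h' x hx, mul_zero]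
    · rintro y ⟨hyK, -⟩
      obtain ⟨c, hc1, hc0⟩ := hφ.separates z y fun g h => hz g (h ▸ hyK)
      refine ⟨_, mem_nhdsWithin_of_mem_nhds ((isOpen_lt
        (X.continuous_eval (φ (star c * c))).norm continuous_const).mem_nhds
        (?_ : ‖X.eval y (φ (star c * c))‖ < 1 / 2)), _, hcut c hc1, fun x hx => hcut0 c x ?_⟩
      · simp only [map_mul, hc0, mul_zero, norm_zero]
        norm_num
      · exact le_of_lt hx
  obtain ⟨s, hs1, hs0⟩ := hloc
  refine ⟨s * cfcₙ cut (star b * b), ?_, fun x hx => ?_⟩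
  · rw [map_mul, map_mul, hs1, hcut b hb, one_mul]
  · rw [map_mul, map_mul]
    rcases le_or_gt (1 / 2) ‖X.eval x (φ (star b * b))‖ with h | h
    · rw [hs0 x ⟨hx, h⟩, zero_mul]
    · rw [hcut0 b x h.le, mul_zero]

/-- Near a given point, some elements act like a projection of rank one together with a system of
vectors that moves its range to an orthonormal basis. -/
theorem IsRich.exists_sum_eq_smul_one [NeZero n] (hφ : IsRich φ) (z : X) :
    ∃ (p : A) (a b : Fin n → A), ∃ V ∈ nhds z, (X.eval z (φ p)).trace = 1 ∧ ∀ x ∈ V, ∀ T,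
      ∑ i, X.eval x (φ (a i)) * (X.eval x (φ p) * T * X.eval x (φ p)) * X.eval x (φ (b i)) =
        (X.eval x (φ p) * T).trace • (1 : Mat n) := by
  let E : Mat n := Matrix.single 0 0 1
  have hEE : E * E = E := by simp [E]
  have hEs : star E = E := by simp [E, Matrix.star_eq_conjTranspose]
  have hEt : E.trace = 1 := by simp [E]
  obtain ⟨e, he⟩ := hφ.surjective z E
  choose a ha using fun i => hφ.surjective z (Matrix.single i 0 1)
  have hsa : IsSelfAdjoint (star e * e) := .star_mul_self e
  have hes : X.eval z (φ (star e * e)) = E := by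
    rw [map_mul, map_mul, map_star, map_star, he, hEs, hEE]
  let p := cfcₙ step (star e * e)
  have hp : ∀ x, X.eval x (φ p) = cfc step (X.eval x (φ (star e * e))) := fun x =>
    eval_cfcₙ φ x continuous_step (step_of_le (by norm_num)) hsa
  have hpz : X.eval z (φ p) = E := by
    rw [hp, hes, cfc_step_of_isIdempotent hEs hEE]
  -- At `z` this is the sum of the diagonal matrix units, so it stays close to 1 nearby; `q` inverts
  -- it there to make the sum exactly 1.
  let d := ∑ i, a i * p * star (a i)
  have hdsa : IsSelfAdjoint d := by
    have hps : IsSelfAdjoint p := cfcₙ_predicate _ _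
    refine isSelfAdjoint_sum _ fun i _ => ?_
    exact hps.conjugate (a i)
  have hdx : ∀ x, X.eval x (φ d) =
      ∑ i, X.eval x (φ (a i)) * X.eval x (φ p) * X.eval x (φ (star (a i))) := by
    intro x
    simp only [d, map_sum, map_mul]
  have hdz : X.eval z (φ d) = 1 := by
    have h1 : ∀ i, X.eval z (φ (star (a i))) = Matrix.single 0 i 1 := by
      intro i
      rw [map_star, map_star, ha]
      simp [Matrix.star_eq_conjTranspose]
    simp only [hdx, h1, ha, hpz, E]
    rw [sum_single_mul_single]
    simp
  let q := cfcₙ approxInv d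
  have hq : ∀ x, X.eval x (φ q) = cfc approxInv (X.eval x (φ d)) := fun x =>
    eval_cfcₙ φ x continuous_approxInv (by simp [approxInv]) hdsa
  refine ⟨p, a, fun i => star (a i) * q, {x | ‖X.eval x (φ (star e * e)) *
    X.eval x (φ (star e * e)) - X.eval x (φ (star e * e))‖ < 3 / 16 ∧
    ‖(X.eval x (φ p)).trace - 1‖ < 1 ∧ ‖X.eval x (φ d) - 1‖ < 1 / 2}, ?_, by rw [hpz, hEt], ?_⟩
  · have hc1 := X.continuous_eval (φ (star e * e))
    have hc2 := X.continuous_eval (φ p)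
    have hc3 := X.continuous_eval (φ d)
    refine (((isOpen_lt (f := fun x => ‖X.eval x (φ (star e * e)) * X.eval x (φ (star e * e)) -
      X.eval x (φ (star e * e))‖) (by fun_prop) continuous_const).inter
      ((isOpen_lt (f := fun x => ‖(X.eval x (φ p)).trace - 1‖)
        ((hc2.matrix_trace.sub continuous_const).norm) continuous_const).inter
      (isOpen_lt (f := fun x => ‖X.eval x (φ d) - 1‖) (by fun_prop) continuous_const)))).mem_nhds
      ⟨?_, ?_, ?_⟩
    · change ‖_‖ < _
      rw [hes, hEE, sub_self, norm_zero]
      norm_num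
    · change ‖_‖ < _
      rw [hpz, hEt, sub_self, norm_zero]
      norm_num
    · change ‖_‖ < _
      rw [hdz, sub_self, norm_zero]
      norm_num
  · rintro x ⟨h1, h2, h3⟩ T
    have hpp : X.eval x (φ p) * X.eval x (φ p) = X.eval x (φ p) := by
      rw [hp, cfc_step_mul_self (isSelfAdjoint_eval φ x hsa) h1]
    have htr := trace_eq_one_of_mul_self hpp h2
    have hdq : X.eval x (φ d) * X.eval x (φ q) = 1 := by
      rw [hq, mul_cfc_approxInv (isSelfAdjoint_eval φ x hdsa) h3.le]
    rw [mul_mul_eq_trace_smul _ T hpp htr]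
    simp only [map_mul, mul_smul_comm, smul_mul_assoc]
    rw [← Finset.smul_sum, ← hdq, hdx, Finset.sum_mul]
    simp only [mul_assoc]

end StoneWeierstrass

theorem eval_sub {n : ℕ} {X : NSpace.{w} n} (x : X) (f h : X.cstar) :
    X.eval x (f - h) = X.eval x f - X.eval x h := rfl

section StoneWeierstrass

variable {n : ℕ} [NeZero n] {A : Type u} [NonUnitalCStarAlgebra A] {X : NSpace.{w} n}
  {φ : A →⋆ₙₐ[ℂ] X.cstar}

/-- Sandwiching `s` by the rank-one `p` and summing over the basis yields the scalar `tr(ps)` near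
`z`. Equivariance spreads this over the saturation of `W`, and `s` is chosen to vanish elsewhere. -/
theorem IsRich.exists_scalar (hφ : IsRich φ) (z : X) {U : Set X} (hU : IsOpen U)
    (hz : ∀ g : PU n, g • z ∈ U) : ∃ c, X.eval z (φ c) = 1 ∧
      (∀ x, ∃ μ : ℂ, X.eval x (φ c) = μ • (1 : Mat n)) ∧ ∀ x ∉ U, X.eval x (φ c) = 0 := by
  obtain ⟨p, a, b, V, hV, hpt, hab⟩ := hφ.exists_sum_eq_smul_one z
  obtain ⟨W, hWV, hW, hzW⟩ := mem_nhds_iff.1 hV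
  have hGW : IsOpen (⋃ g : PU n, (fun x : X => g • x) ⁻¹' W) :=
    isOpen_iUnion fun g => hW.preimage (continuous_const_smul g)
  obtain ⟨s, hs1, hs0⟩ := hφ.exists_eq_one_of_isClosed z
    (K := (U ∩ ⋃ g : PU n, (fun x : X => g • x) ⁻¹' W)ᶜ) (hU.inter hGW).isClosed_compl
    fun g => not_not_intro ⟨hz g, Set.mem_iUnion.2 ⟨g⁻¹, by simpa using hzW⟩⟩
  let c := ∑ i, a i * (p * s * p) * b i
  have hc : ∀ x, X.eval x (φ c) = ∑ i, X.eval x (φ (a i)) *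
      (X.eval x (φ p) * X.eval x (φ s) * X.eval x (φ p)) * X.eval x (φ (b i)) := by
    intro x
    simp only [c, map_sum, map_mul]
  have hc0 : ∀ x, X.eval x (φ s) = 0 → X.eval x (φ c) = 0 := by
    intro x hx
    simp [hc, hx]
  refine ⟨c, ?_, fun x => ?_, fun x hx => hc0 x (hs0 x fun h => hx h.1)⟩
  · rw [hc, hab z (mem_of_mem_nhds hV), hs1, mul_one, hpt, one_smul]
  · by_cases hx : x ∈ ⋃ g : PU n, (fun x : X => g • x) ⁻¹' W
    · obtain ⟨g, hg⟩ := Set.mem_iUnion.1 hx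
      refine ⟨(X.eval (g • x) (φ p) * X.eval (g • x) (φ s)).trace, ?_⟩
      have h1 := hab (g • x) (hWV hg) (X.eval (g • x) (φ s))
      rw [← hc, X.eval_smul g x (φ c)] at h1
      have h2 := congrArg (conj n g⁻¹) h1
      rw [conj_inv_conj, map_smul, map_one] at h2
      exact h2
    · exact ⟨0, by rw [hc0 x (hs0 x fun h => hx h.2), zero_smul]⟩

theorem IsRich.exists_bump (hφ : IsRich φ) (z : X) {U : Set X} (hU : IsOpen U)
    (hz : ∀ g : PU n, g • z ∈ U) : ∃ c, ∃ l : X → ℝ,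
      (∀ x, X.eval x (φ c) = (l x : ℂ) • (1 : Mat n)) ∧ (∀ x, 0 ≤ l x) ∧ (∀ x, l x ≤ 1) ∧
      (∀ x ∉ U, l x = 0) ∧ ∃ V ∈ nhds z, ∀ x ∈ V, l x = 1 := by
  obtain ⟨c, hc1, hc, hc0⟩ := hφ.exists_scalar z hU hz
  refine ⟨cfcₙ clamp (star c * c), fun x => clamp (‖X.eval x (φ c)‖ ^ 2), fun x => ?_,
    fun x => clamp_nonneg _, fun x => clamp_le_one _, fun x hx => ?_,
    {x | 1 / 2 < ‖X.eval x (φ c)‖ ^ 2}, ?_, fun x hx => clamp_of_ge (le_of_lt hx)⟩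
  · obtain ⟨μ, hμ⟩ := hc x
    rw [eval_cfcₙ φ x continuous_clamp clamp_zero (.star_mul_self c)]
    have h1 : X.eval x (φ (star c * c)) = algebraMap ℝ (Mat n) (‖X.eval x (φ c)‖ ^ 2) := by
      rw [map_mul, map_mul, map_star, map_star, hμ, norm_smul, norm_one, mul_one, star_smul,
        star_one, smul_mul_smul_comm, one_mul, Algebra.algebraMap_eq_smul_one, Complex.star_def,
        Complex.conj_mul']
      norm_cast
    rw [h1, cfc_algebraMap, Algebra.algebraMap_eq_smul_one]
    rfl
  · simp only [hc0 x hx, norm_zero]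
    norm_num [clamp_zero]
  · refine (isOpen_lt continuous_const ((X.continuous_eval (φ c)).norm.pow 2)).mem_nhds ?_
    change 1 / 2 < ‖X.eval z (φ c)‖ ^ 2
    rw [hc1, norm_one]
    norm_num

/-- The error is bounded by `ε * l`, not just `ε`, so that patches can be combined without the
errors accumulating. -/
theorem IsRich.exists_approx (hφ : IsRich φ) (f : X.cstar) {ε : ℝ} (hε : 0 < ε) {K : Set X}
    (hK : IsCompact K) : ∃ a c, ∃ l : X → ℝ,
      (∀ x, X.eval x (φ c) = (l x : ℂ) • (1 : Mat n)) ∧ (∀ x, 0 ≤ l x) ∧ (∀ x, l x ≤ 1) ∧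
      (∀ x ∈ K, l x = 1) ∧ ∀ x, ‖X.eval x (φ a) - (l x : ℂ) • X.eval x f‖ ≤ ε * l x := by
  refine hK.induction_on (p := fun K => ∃ a c, ∃ l : X → ℝ,
      (∀ x, X.eval x (φ c) = (l x : ℂ) • (1 : Mat n)) ∧ (∀ x, 0 ≤ l x) ∧ (∀ x, l x ≤ 1) ∧
      (∀ x ∈ K, l x = 1) ∧ ∀ x, ‖X.eval x (φ a) - (l x : ℂ) • X.eval x f‖ ≤ ε * l x)
    ⟨0, 0, 0, by simp⟩ ?_ ?_ ?_
  · rintro S T hST ⟨a, c, l, h1, h2, h3, h4, h5⟩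
    exact ⟨a, c, l, h1, h2, h3, fun x hx => h4 x (hST hx), h5⟩
  · rintro S T ⟨a, c, l, h1, h2, h3, h4, h5⟩ ⟨a', c', l', h1', h2', h3', h4', h5'⟩
    -- The weights satisfy `1 - l'' = (1 - l)(1 - l')`; multiplication by `1 - l` is `a' - c * a'`,
    -- so no unit in `A` is needed.
    refine ⟨a + a' - c * a', c + c' - c * c', fun x => l x + (1 - l x) * l' x, fun x => ?_,
      fun x => ?_, fun x => ?_, ?_, fun x => ?_⟩
    · simp only [map_add, map_sub, map_mul, h1, h1', smul_mul_smul_comm, one_mul, ← add_smul,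
        ← sub_smul]
      push_cast
      ring_nf
    · have := h2 x; have := h2' x; have := h3 x
      nlinarith
    · have := h2 x; have := h3' x; have := h3 x
      nlinarith
    · rintro x (hx | hx)
      · simp only [h4 x hx]; ring
      · simp only [h4' x hx]; ring
    · have h6 : X.eval x (φ (a + a' - c * a')) - ((l x + (1 - l x) * l' x : ℝ) : ℂ) • X.eval x f =
          (X.eval x (φ a) - (l x : ℂ) • X.eval x f) +
          ((1 - l x : ℝ) : ℂ) • (X.eval x (φ a') - (l' x : ℂ) • X.eval x f) := by
        simp only [map_add, map_sub, map_mul, h1, smul_mul_assoc, one_mul]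
        push_cast
        module
      rw [h6]
      refine (norm_add_le _ _).trans ?_
      rw [norm_smul, Complex.norm_real, Real.norm_of_nonneg (sub_nonneg.2 (h3 x))]
      have := mul_le_mul_of_nonneg_left (h5' x) (sub_nonneg.2 (h3 x))
      linarith [h5 x]
  · intro z _
    obtain ⟨a, ha⟩ := hφ.surjective z (X.eval z f)
    have hU : IsOpen {x | ‖X.eval x (φ a - f)‖ < ε} :=
      isOpen_lt (X.continuous_eval _).norm continuous_const
    obtain ⟨c, l, h1, h2, h3, h4, V, hV, h5⟩ := hφ.exists_bump z hU fun g => by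
      change ‖X.eval (g • z) (φ a - f)‖ < ε
      rwa [X.eval_smul, norm_conj, eval_sub, ha, sub_self, norm_zero]
    refine ⟨V, mem_nhdsWithin_of_mem_nhds hV, c * a, c, l, h1, h2, h3, h5, fun x => ?_⟩
    rw [map_mul, map_mul, h1, smul_mul_assoc, one_mul, ← smul_sub, ← eval_sub, norm_smul,
      Complex.norm_real, Real.norm_of_nonneg (h2 x), mul_comm]
    by_cases hx : x ∈ {x | ‖X.eval x (φ a - f)‖ < ε}
    · exact mul_le_mul_of_nonneg_right (le_of_lt hx) (h2 x)
    · rw [h4 x hx, mul_zero, mul_zero]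

theorem norm_le_of_forall_eval {n : ℕ} {X : NSpace.{w} n} (f : X.cstar) {r : ℝ} (hr : 0 ≤ r)
    (h : ∀ x, ‖X.eval x f‖ ≤ r) : ‖f‖ ≤ r :=
  (BoundedContinuousFunction.norm_le hr).2 h

/-- A noncommutative Stone-Weierstrass theorem for the algebra of an `n`-space. -/
theorem IsRich.bijective (hφ : IsRich φ) (hinj : Function.Injective φ) :
    Function.Bijective φ := by
  refine ⟨hinj, Set.range_eq_univ.1 ?_⟩
  have hcl : IsClosed (Set.range φ) :=
    (NonUnitalStarAlgHom.isometry φ hinj).isClosedEmbedding.isClosed_range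
  rw [← hcl.closure_eq, Set.eq_univ_iff_forall]
  intro f
  rw [Metric.mem_closure_iff]
  intro ε hε
  -- Off the compact set `f` itself is below `ε / 4`, so both `φ a - l f` and `(1 - l) f` are at
  -- most `ε / 4` everywhere.
  obtain ⟨a, c, l, -, h2, h3, h4, h5⟩ := hφ.exists_approx f (ε := ε / 4) (by linarith)
    (X.isCompact_le_norm f (ε := ε / 4) (by linarith))
  refine ⟨φ a, ⟨a, rfl⟩, ?_⟩
  have hd : dist f (φ a) = ‖φ a - f‖ := (dist_comm f (φ a)).trans (dist_eq_norm (φ a).1 f.1)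
  rw [hd]
  refine (norm_le_of_forall_eval _ (by linarith : 0 ≤ ε / 2) fun x => ?_).trans_lt
    (by linarith)
  have h6 : X.eval x (φ a - f) = (X.eval x (φ a) - (l x : ℂ) • X.eval x f) -
      ((1 - l x : ℝ) : ℂ) • X.eval x f := by
    rw [eval_sub]
    push_cast
    module
  have h7 : ‖((1 - l x : ℝ) : ℂ) • X.eval x f‖ ≤ ε / 4 := by
    rw [norm_smul, Complex.norm_real, Real.norm_of_nonneg (sub_nonneg.2 (h3 x))]
    by_cases hx : ε / 4 ≤ ‖X.eval x f‖
    · rw [h4 x hx]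
      linarith
    · have := h2 x
      nlinarith [norm_nonneg (X.eval x f)]
  have h8 := h5 x
  have h9 := mul_le_mul_of_nonneg_left (h3 x) (by linarith : 0 ≤ ε / 4)
  rw [h6]
  linarith [norm_sub_le (X.eval x (φ a) - (l x : ℂ) • X.eval x f)
    (((1 - l x : ℝ) : ℂ) • X.eval x f)]

end StoneWeierstrass

/-! ### Existence of the `n`-space -/

section Existence

variable {n : ℕ} {A : Type u} [NonUnitalCStarAlgebra A]

/-- Two surjective `*`-homomorphisms to `M_n` whose kernels are comparable are conjugate. -/
theorem exists_conj_comp_eq {A : Type*} [NonUnitalRing A] [Module ℂ A] [Star A]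
    (ρ σ : A →⋆ₙₐ[ℂ] Mat n) (hρ : Function.Surjective ρ) (hσ : Function.Surjective σ)
    (h : ∀ a, ρ a = 0 → σ a = 0) : ∃ g : PU n, ∀ a, σ a = conj n g (ρ a) := by
  obtain ⟨α, hα⟩ := exists_starAlgHom_comp_eq ρ hρ σ fun a b hab => by
    rw [← sub_eq_zero, ← map_sub] at hab ⊢
    exact h _ hab
  obtain ⟨g, hg⟩ := exists_eq_conj α fun T => by
    obtain ⟨a, ha⟩ := hσ T
    exact ⟨ρ a, (hα a).trans ha⟩
  exact ⟨g, fun a => by rw [← hα, hg]⟩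

/-- If a surjective `*`-homomorphism to `M_n` does not vanish on the kernel of another
`*`-homomorphism, its restriction to this kernel attains the value `1`. -/
theorem exists_eq_one_of_ne_zero {A : Type*} [NonUnitalRing A] [Module ℂ A] [Star A]
    (ρ σ : A →⋆ₙₐ[ℂ] Mat n) (hρ : Function.Surjective ρ) {c : A} (hc : ρ c ≠ 0) (h0 : σ c = 0) :
    ∃ a, ρ a = 1 ∧ σ a = 0 := by
  obtain ⟨i, j, hij⟩ : ∃ i j, ρ c i j ≠ 0 := by
    by_contra! h
    exact hc (by ext i j; exact h i j)
  choose f hf using hρ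
  refine ⟨(ρ c i j)⁻¹ • ∑ k, f (Matrix.single k i 1) * c * f (Matrix.single j k 1), ?_, ?_⟩
  · simp only [map_smul, map_sum, map_mul, hf]
    rw [sum_single_mul_single, inv_smul_smul₀ hij]
  · simp [h0]

/-- If `x` vanished on the kernel of `y`, the two would be conjugate and share an orbit. Otherwise
`x` maps that kernel onto a nonzero ideal of `M_n`, which contains 1. -/
theorem IsHomogeneous.isRich_gelfand (hA : IsHomogeneous n A) :
    IsRich (IsHomogeneous.gelfand.{u, v} hA) where
  surjective x T := hA.surjective x.down.hom x.down.hom_ne_zero T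
  separates x y hxy := by
    have hx := hA.surjective x.down.hom x.down.hom_ne_zero
    have hy := hA.surjective y.down.hom y.down.hom_ne_zero
    have h1 : ∃ c, x.down.hom c ≠ 0 ∧ y.down.hom c = 0 := by
      by_contra! h
      obtain ⟨g, hg⟩ := exists_conj_comp_eq _ _ hy hx fun a ha => by
        by_contra h'
        exact h a h' ha
      refine hxy g⁻¹ (congrArg ULift.up (Spec.ext (x := g⁻¹ • x.down) (y := y.down) fun a => ?_))
      rw [Spec.smul_hom, hg, conj_inv_conj]
    obtain ⟨c, hc, hc0⟩ := h1
    exact exists_eq_one_of_ne_zero x.down.hom y.down.hom hx hc hc0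

theorem IsHomogeneous.exists_equiv [NeZero n] (hA : IsHomogeneous n A) :
    ∃ X : NSpace.{max u v} n, Nonempty (A ≃⋆ₐ[ℂ] X.cstar) :=
  ⟨_, ⟨StarAlgEquiv.ofBijective (IsHomogeneous.gelfand.{u, v} hA)
    (hA.isRich_gelfand.bijective hA.gelfand_injective)⟩⟩

end Existence

/-! ### Haar averaging: evaluations are surjective and separate points -/

section Average

open MeasureTheory

variable {n : ℕ}

instance : MeasurableSpace (PU n) := borel _

instance : BorelSpace (PU n) := ⟨rfl⟩

/-- The Haar probability measure of `U(n) / 𝕋`. -/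
def haarPU (n : ℕ) : Measure (PU n) := Measure.haarMeasure ⊤

instance : IsProbabilityMeasure (haarPU n) :=
  ⟨by
    have h := Measure.haarMeasure_self (K₀ := (⊤ : TopologicalSpace.PositiveCompacts (PU n)))
    rwa [TopologicalSpace.PositiveCompacts.coe_top] at h⟩

instance : (haarPU n).IsMulLeftInvariant :=
  inferInstanceAs (Measure.haarMeasure ⊤).IsMulLeftInvariant

theorem integrable_haarPU {F : PU n → Mat n} (hF : Continuous F) : Integrable F (haarPU n) := by
  obtain ⟨C, hC⟩ := isCompact_univ.exists_bound_of_continuousOn hF.continuousOn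
  exact Integrable.of_bound hF.aestronglyMeasurable C
    (Filter.Eventually.of_forall fun g => hC g trivial)

theorem continuous_integral_haarPU :
    Continuous fun F : C(PU n, Mat n) => ∫ g, F g ∂(haarPU n) := by
  refine LipschitzWith.continuous (K := 1) (LipschitzWith.of_dist_le_mul fun F F' => ?_)
  rw [dist_eq_norm, ← integral_sub (integrable_haarPU F.continuous)
    (integrable_haarPU F'.continuous), dist_eq_norm]
  refine (norm_integral_le_of_norm_le_const (C := ‖F - F'‖)
    (Filter.Eventually.of_forall fun g => (F - F').norm_coe_le_norm g)).trans ?_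
  simp

/-- Averaging produces elements of the algebra of an `n`-space. -/
theorem exists_cstar_of_hasCompactSupport (X : NSpace.{u} n) (F : C(X, Mat n)) {K : Set X}
    (hK : IsCompact K) (hF : ∀ x ∉ K, F x = 0) :
    ∃ f : X.cstar, ∀ x T, (∀ g : PU n, F (g • x) = conj n g T) → X.eval x f = T := by
  -- Left invariance makes the integral over the group equivariant; on an orbit where `F` is already
  -- equivariant the integrand is constant.
  let Q : C(X × PU n, Mat n) := ⟨fun p => conj n p.2 (F (p.2⁻¹ • p.1)),
    continuous_conj.comp (continuous_snd.prodMk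
      (F.continuous.comp (continuous_snd.inv.smul continuous_fst)))⟩
  let avg : X → Mat n := fun x => ∫ g, Q (x, g) ∂(haarPU n)
  have havg : Continuous avg := continuous_integral_haarPU.comp Q.curry.continuous
  have hGK : IsCompact ((fun p : PU n × X => p.1 • p.2) '' (Set.univ ×ˢ K)) :=
    (isCompact_univ.prod hK).image continuous_smul
  have hsupp : ∀ x ∉ (fun p : PU n × X => p.1 • p.2) '' (Set.univ ×ˢ K), avg x = 0 := by
    intro x hx
    have h1 : ∀ g, Q (x, g) = 0 := by
      intro g
      change conj n g (F (g⁻¹ • x)) = 0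
      rw [hF _ fun h => hx ⟨(g, g⁻¹ • x), ⟨trivial, h⟩, smul_inv_smul g x⟩, map_zero]
    simp [avg, h1]
  refine ⟨⟨⟨⟨avg, havg⟩, ?_⟩, fun h x => ?_⟩, fun x T hT => ?_⟩
  · refine tendsto_const_nhds.congr' ?_
    filter_upwards [hGK.compl_mem_cocompact] with x hx
    exact (hsupp x hx).symm
  · let L : Mat n →L[ℂ] Mat n :=
      LinearMap.toContinuousLinearMap ((conj n h : Mat n ≃⋆ₐ[ℂ] Mat n) : Mat n →ₗ[ℂ] Mat n)
    have hL : ∀ T, L T = conj n h T := fun T => rfl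
    have hL_mul : ∫ g, Q (h • x, h * g) ∂(haarPU n) = avg (h • x) :=
      integral_mul_left_eq_self (fun g => Q (h • x, g)) h
    change avg (h • x) = conj n h (avg x)
    have h1 : conj n h (avg x) = ∫ g, L (Q (x, g)) ∂(haarPU n) :=
      (L.integral_comp_comm (integrable_haarPU (Q.curry x).continuous)).symm
    rw [h1, ← hL_mul]
    refine integral_congr_ae (Filter.Eventually.of_forall fun g => ?_)
    change conj n (h * g) (F ((h * g)⁻¹ • h • x)) = L (conj n g (F (g⁻¹ • x)))
    rw [hL, conj_conj, smul_smul, mul_inv_rev, inv_mul_cancel_right]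
  · change ∫ g, conj n g (F (g⁻¹ • x)) ∂(haarPU n) = T
    have h1 : ∀ g, conj n g (F (g⁻¹ • x)) = T := by
      intro g
      rw [hT, conj_conj, mul_inv_cancel, map_one]
      rfl
    simp [h1]

/-- Freeness makes `g • x ↦ conj n g T` well defined on the orbit. It is extended by Tietze on the
one-point compactification, which is normal, then damped by a bump vanishing on `t` and averaged. -/
theorem exists_eval_eq_of_isClosed (X : NSpace.{u} n) (x : X) (T : Mat n) {t : Set X}
    (ht : IsClosed t) (hxt : ∀ g : PU n, g • x ∉ t) :
    ∃ f : X.cstar, X.eval x f = T ∧ ∀ y, (∀ g : PU n, g • y ∈ t) → X.eval y f = 0 := by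
  have horb : Continuous fun g : PU n => g • x := continuous_id.smul continuous_const
  have hinj : Function.Injective fun g : PU n => (g • x : X) := by
    intro g h hgh
    have h1 : (h⁻¹ * g) • x = x := by
      rw [mul_smul, inv_smul_eq_iff]
      exact hgh
    exact (inv_mul_eq_one.1 (X.free _ _ h1)).symm
  have he : Topology.IsClosedEmbedding fun g : PU n => ((g • x : X) : OnePoint X) :=
    (OnePoint.continuous_coe.comp horb).isClosedEmbedding (OnePoint.coe_injective.comp hinj)
  have : TietzeExtension (Mat n) := RCLike.instTietzeExtensionTVS (𝕜 := ℂ)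
  obtain ⟨F₀, hF₀⟩ := ContinuousMap.exists_extension' he
    ⟨fun g : PU n => conj n g T, continuous_conj.comp (continuous_id.prodMk continuous_const)⟩
  obtain ⟨χ, hχ1, hχ0, hχc, -⟩ := exists_continuous_one_zero_of_isCompact
    (isCompact_range horb) ht (Set.disjoint_left.2 (by rintro _ ⟨g, rfl⟩; exact hxt g))
  let F : C(X, Mat n) := ⟨fun y => (χ y : ℂ) • F₀ (y : OnePoint X),
    (Complex.continuous_ofReal.comp χ.continuous).smul
      (F₀.continuous.comp OnePoint.continuous_coe)⟩
  obtain ⟨f, hf⟩ := exists_cstar_of_hasCompactSupport X F hχc fun y hy => by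
    change (χ y : ℂ) • _ = (0 : Mat n)
    rw [image_eq_zero_of_notMem_tsupport hy, Complex.ofReal_zero, zero_smul]
  refine ⟨f, hf x T fun g => ?_, fun y hy => hf y 0 fun g => ?_⟩
  · change (χ (g • x) : ℂ) • F₀ ((g • x : X) : OnePoint X) = _
    rw [hχ1 ⟨g, rfl⟩, Pi.one_apply, Complex.ofReal_one, one_smul]
    exact congrFun hF₀ g
  · change (χ (g • y) : ℂ) • F₀ ((g • y : X) : OnePoint X) = _
    rw [hχ0 (hy g), Pi.zero_apply, Complex.ofReal_zero, zero_smul, map_zero]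

theorem eval_surjective (X : NSpace.{u} n) (x : X) : Function.Surjective (X.eval x) := by
  intro T
  obtain ⟨f, hf, -⟩ := exists_eval_eq_of_isClosed X x T isClosed_empty fun _ => id
  exact ⟨f, hf⟩

theorem eval_injective [NeZero n] (X : NSpace.{u} n) {x y : X}
    (h : ∀ f, X.eval x f = X.eval y f) : x = y := by
  by_cases hxy : ∃ g : PU n, g • x = y
  · obtain ⟨g, rfl⟩ := hxy
    have hg : g = 1 := eq_one_of_conj_eq g fun T => by
      obtain ⟨f, rfl⟩ := eval_surjective X x T
      rw [← X.eval_smul, h]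
    rw [hg, one_smul]
  · push Not at hxy
    have hcl : IsClosed (Set.range fun g : PU n => g • y) :=
      (isCompact_range (continuous_id.smul continuous_const)).isClosed
    obtain ⟨f, hf1, hf0⟩ := exists_eval_eq_of_isClosed X x 1 hcl (by
      rintro g ⟨g', hg'⟩
      exact hxy (g'⁻¹ * g) (by rw [mul_smul, inv_smul_eq_iff]; exact hg'.symm))
    have h1 := h f
    rw [hf1, hf0 y fun g => ⟨g, rfl⟩] at h1
    exact absurd h1 one_ne_zero

end Average

/-! ### Prime kernels and irreducible representations of `X.cstar` -/

section Irreducible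

variable {n : ℕ}

theorem exists_cutoff (X : NSpace.{u} n) (f : X.cstar) {ε : ℝ} (hε : 0 < ε) :
    ∃ h : X.cstar, ‖f - h‖ ≤ ε ∧ ∀ x, ‖X.eval x f‖ ≤ ε → X.eval x h = 0 := by
  -- Scaling `f` by `χ ‖f‖` shrinks its norm by `min ‖f‖ ε` pointwise, and keeps equivariance
  -- because conjugation is isometric.
  let χ : ℝ → ℝ := fun t => 1 - ε / max t ε
  have hmax : ∀ t, 0 < max t ε := fun t => lt_max_of_lt_right hε
  have hχc : Continuous χ :=
    continuous_const.sub (continuous_const.div (by fun_prop) fun t => (hmax t).ne')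
  have hχ0 : ∀ t, 0 ≤ χ t := fun t => sub_nonneg.2 ((div_le_one (hmax t)).2 (le_max_right _ _))
  have hχ1 : ∀ t, χ t ≤ 1 := fun t => sub_le_self _ (div_nonneg hε.le (hmax t).le)
  have hχε : ∀ t, t ≤ ε → χ t = 0 := fun t ht => by
    simp only [χ, max_eq_right ht, div_self hε.ne', sub_self]
  have hχt : ∀ t, 0 ≤ t → (1 - χ t) * t ≤ ε := fun t _ => by
    simp only [χ, sub_sub_cancel]
    rw [div_mul_eq_mul_div, div_le_iff₀ (hmax t)]
    exact mul_le_mul_of_nonneg_left (le_max_left _ _) hε.le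
  let h : X.cstar := ⟨⟨⟨fun x => (χ ‖X.eval x f‖ : ℂ) • X.eval x f,
    (Complex.continuous_ofReal.comp (hχc.comp (X.continuous_eval f).norm)).smul
      (X.continuous_eval f)⟩, by
      refine squeeze_zero_norm (a := fun x => ‖X.eval x f‖) (fun x => ?_) ?_
      · change ‖(χ ‖X.eval x f‖ : ℂ) • X.eval x f‖ ≤ _
        rw [norm_smul, Complex.norm_real, Real.norm_of_nonneg (hχ0 _)]
        exact mul_le_of_le_one_left (norm_nonneg _) (hχ1 _)
      · have := (zero_at_infty f.1).norm
        rwa [norm_zero] at this⟩, fun g x => by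
      change (χ ‖X.eval (g • x) f‖ : ℂ) • X.eval (g • x) f =
        conj n g ((χ ‖X.eval x f‖ : ℂ) • X.eval x f)
      rw [X.eval_smul, norm_conj, map_smul]⟩
  have hh : ∀ x, X.eval x h = (χ ‖X.eval x f‖ : ℂ) • X.eval x f := fun x => rfl
  refine ⟨h, norm_le_of_forall_eval _ hε.le fun x => ?_, fun x hx => by simp [hh, hχε _ hx]⟩
  have h1 : X.eval x (f - h) = ((1 - χ ‖X.eval x f‖ : ℝ) : ℂ) • X.eval x f := by
    rw [eval_sub, hh]
    push_cast
    module
  rw [h1, norm_smul, Complex.norm_real, Real.norm_of_nonneg (sub_nonneg.2 (hχ1 _))]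
  exact hχt _ (norm_nonneg _)

/-- A nonzero `*`-homomorphism with a prime kernel factors through the evaluation at a point. -/
theorem exists_eval_ker_le {D : Type*} [NonUnitalCStarAlgebra D] (X : NSpace.{u} n)
    (ρ : X.cstar →⋆ₙₐ[ℂ] D) {f₀ : X.cstar} (h0 : ρ f₀ ≠ 0)
    (hρ : ∀ S T, (∀ c, ρ (S * c * T) = 0) → ρ S = 0 ∨ ρ T = 0) :
    ∃ x, ∀ f, X.eval x f = 0 → ρ f = 0 := by
  have hcut : ∀ f, ρ f ≠ 0 → ∃ (ε : ℝ) (h : X.cstar), 0 < ε ∧ ρ h ≠ 0 ∧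
      ∀ x, ‖X.eval x f‖ ≤ ε → X.eval x h = 0 := by
    intro f hf
    -- By contractivity, a change of `f` by half of `‖ρ f‖` cannot make its image vanish.
    have hε : 0 < ‖ρ f‖ / 2 := half_pos (norm_pos_iff.2 hf)
    obtain ⟨h, hfh, hh⟩ := exists_cutoff X f hε
    refine ⟨_, h, hε, fun h1 => ?_, hh⟩
    have h2 := NonUnitalStarAlgHom.norm_apply_le ρ (f - h)
    have h3 : ρ (f - h) = ρ f := (map_sub ρ f h).trans (by rw [h1, sub_zero])
    rw [h3] at h2
    linarith
  -- Otherwise primeness and compactness give `k` with `ρ k ≠ 0` vanishing where `f₀` is large,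
  -- while `h` vanishes where it is small; then `h * c * k = 0` for all `c`, against primeness.
  by_contra! hcon
  obtain ⟨ε, h, hε, hρh, hh⟩ := hcut f₀ h0
  have hind : ∃ k, ρ k ≠ 0 ∧ ∀ x ∈ {x | ε ≤ ‖X.eval x f₀‖}, X.eval x k = 0 := by
    refine (X.isCompact_le_norm f₀ hε).induction_on
      (p := fun S => ∃ k, ρ k ≠ 0 ∧ ∀ x ∈ S, X.eval x k = 0) ⟨f₀, h0, by simp⟩
      (fun s t hst ⟨k, hk, hkt⟩ => ⟨k, hk, fun x hx => hkt x (hst hx)⟩) ?_ ?_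
    · rintro s t ⟨k, hk, hks⟩ ⟨k', hk', hkt⟩
      obtain ⟨c, hc⟩ : ∃ c, ρ (k * c * k') ≠ 0 := by
        by_contra! h1
        exact (hρ k k' h1).elim hk hk'
      refine ⟨_, hc, ?_⟩
      rintro x (hx | hx)
      · rw [map_mul, map_mul, hks x hx, zero_mul, zero_mul]
      · rw [map_mul, hkt x hx, mul_zero]
    · intro x _
      obtain ⟨f, hfx, hf⟩ := hcon x
      obtain ⟨δ, k, hδ, hk, hkδ⟩ := hcut f hf
      refine ⟨_, mem_nhdsWithin_of_mem_nhds ((isOpen_lt (X.continuous_eval f).norm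
        (continuous_const (y := δ))).mem_nhds ?_), k, hk, fun y hy => hkδ y (le_of_lt hy)⟩
      change ‖X.eval x f‖ < δ
      rwa [hfx, norm_zero]
  obtain ⟨k, hk, hk0⟩ := hind
  refine (hρ h k fun c => ?_).elim hρh hk
  have h1 : h * c * k = 0 := by
    apply Subtype.ext
    ext1 x
    change X.eval x (h * c * k) = 0
    rw [map_mul, map_mul]
    rcases le_or_gt ε ‖X.eval x f₀‖ with hx | hx
    · rw [hk0 x hx, mul_zero]
    · rw [hh x hx.le, zero_mul, zero_mul]
  rw [h1, map_zero]

/-- The vectors killed by all `π S * π c` form a closed invariant subspace containing the range of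
`π T`. If it is zero then `π T = 0`; if it is everything, `c = star S` gives `π S = 0`. -/
theorem IsIrreducible.eq_zero_or_eq_zero {A : Type*} [NonUnitalCStarAlgebra A] {H : Type*}
    [NormedAddCommGroup H] [InnerProductSpace ℂ H] [CompleteSpace H]
    {π : A →⋆ₙₐ[ℂ] (H →L[ℂ] H)} (hπ : IsIrreducible π) (S T : A)
    (h : ∀ c, π (S * c * T) = 0) : π S = 0 ∨ π T = 0 := by
  by_contra! hST
  obtain ⟨hS, hT⟩ := hST
  let K : Submodule ℂ H := ⨅ c : A, LinearMap.ker ((π S * π c : H →L[ℂ] H) : H →ₗ[ℂ] H)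
  have hKmem : ∀ v, v ∈ K ↔ ∀ c, π S (π c v) = 0 := fun v => by
    simp [K, Submodule.mem_iInf]
  have hKcl : IsClosed (K : Set H) := by
    have : (K : Set H) = ⋂ c : A, {v | π S (π c v) = 0} := by
      ext v
      simp [hKmem]
    rw [this]
    exact isClosed_iInter fun c => isClosed_eq (by fun_prop) continuous_const
  rcases hπ K hKcl fun a v hv => (hKmem _).2 fun c => by
    have := (hKmem v).1 hv (c * a)
    rwa [map_mul] at this with h1 | h1
  · apply hT
    ext1 v
    have h2 : π T v ∈ K := (hKmem _).2 fun c => by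
      have h3 := congrArg (fun R : H →L[ℂ] H => R v) (h c)
      rw [map_mul, map_mul] at h3
      exact h3
    rw [h1] at h2
    exact h2
  · apply hS
    have h2 : π S * star (π S) = 0 := by
      ext1 v
      have h3 := (hKmem v).1 (h1 ▸ trivial) (star S)
      rwa [map_star] at h3
    exact CStarRing.mul_star_self_eq_zero_iff _ |>.1 h2

theorem isHomogeneous_of_equiv {A : Type u} [NonUnitalCStarAlgebra A] (X : NSpace.{v} n)
    (Φ : A ≃⋆ₐ[ℂ] X.cstar) : IsHomogeneous n A := by
  intro H _ _ _ π h0 hπ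
  obtain ⟨a, ha⟩ : ∃ a, π a ≠ 0 := by
    by_contra! h
    exact h0 (by ext1 a; exact h a)
  let ρ : X.cstar →⋆ₙₐ[ℂ] (H →L[ℂ] H) := π.comp (Φ.symm : X.cstar →⋆ₙₐ[ℂ] A)
  have hρ : ∀ b, ρ (Φ b) = π b := fun b => congrArg π (Φ.symm_apply_apply b)
  obtain ⟨x, hx⟩ := exists_eval_ker_le X ρ (f₀ := Φ a) (by rwa [hρ]) fun S T hST =>
    hπ.eq_zero_or_eq_zero (Φ.symm S) (Φ.symm T) fun c => by
      rw [← hρ, map_mul Φ, map_mul Φ, Φ.apply_symm_apply, Φ.apply_symm_apply]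
      exact hST _
  obtain ⟨σ, hσ⟩ := exists_starAlgHom_comp_eq (X.eval x) (eval_surjective X x) ρ fun f g hfg => by
    have h1 := hx (f - g) (by rw [eval_sub, hfg, sub_self])
    exact sub_eq_zero.1 ((map_sub ρ f g).symm.trans h1)
  have hσπ : ∀ b, π b = σ (X.eval x (Φ b)) := fun b => by
    rw [← hρ, ← hσ]
  refine finrank_eq_of_isIrreducible σ (fun h => ha ?_) fun K hK hinv => hπ K hK fun b v hv => ?_
  · rw [hσπ, h]; rfl
  · rw [hσπ]
    exact hinv _ v hv

end Irreducible

/-! ### Recovering the `n`-space from its algebra -/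

section Uniqueness

variable {n : ℕ} [NeZero n]

/-- The topology of an `n`-space is the topology of pointwise convergence on its algebra. -/
theorem isInducing_eval (X : NSpace.{u} n) :
    Topology.IsInducing fun (x : X) (f : X.cstar) => X.eval x f := by
  -- Vanishing at infinity makes the extension by 0 continuous; an injective continuous map from a
  -- compact space to a Hausdorff one is an embedding.
  let j : OnePoint X → X.cstar → Mat n := fun p f => p.elim 0 fun x => X.eval x f
  have hj : Continuous j := by
    rw [OnePoint.continuous_iff]
    refine ⟨?_, continuous_pi fun f => X.continuous_eval f⟩
    rw [tendsto_pi_nhds]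
    intro f
    rw [Filter.coclosedCompact_eq_cocompact]
    exact zero_at_infty f.1
  have hne : ∀ x : X, ∃ f, X.eval x f ≠ 0 := fun x => by
    obtain ⟨f, hf⟩ := eval_surjective X x 1
    exact ⟨f, hf ▸ one_ne_zero⟩
  have hinj : Function.Injective j := by
    intro p q hpq
    induction p using OnePoint.rec with
    | infty =>
      induction q using OnePoint.rec with
      | infty => rfl
      | coe y =>
        obtain ⟨f, hf⟩ := hne y
        exact absurd (congrFun hpq f).symm hf
    | coe x =>
      induction q using OnePoint.rec with
      | infty =>
        obtain ⟨f, hf⟩ := hne x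
        exact absurd (congrFun hpq f) hf
      | coe y => exact congrArg _ (eval_injective X fun f => congrFun hpq f)
  exact (hj.isClosedEmbedding hinj).isInducing.comp OnePoint.isOpenEmbedding_coe.isInducing

/-- The pulled-back evaluation is onto `M_n`, so its kernel is prime and it is conjugate to an
evaluation; the conjugation is absorbed by moving the point along its orbit. -/
theorem exists_point_of_equiv {X : NSpace.{v} n} {Y : NSpace.{w} n} (Φ : X.cstar ≃⋆ₐ[ℂ] Y.cstar)
    (y : Y) : ∃ x : X, ∀ f, X.eval x f = Y.eval y (Φ f) := by
  let ρ : X.cstar →⋆ₙₐ[ℂ] Mat n := (Y.eval y).comp (Φ : X.cstar →⋆ₙₐ[ℂ] Y.cstar)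
  have hρ : Function.Surjective ρ := (eval_surjective Y y).comp (EquivLike.surjective Φ)
  obtain ⟨f₀, hf₀⟩ := hρ 1
  obtain ⟨x, hx⟩ := exists_eval_ker_le X ρ (f₀ := f₀) (hf₀ ▸ one_ne_zero) fun S T h =>
    eq_zero_or_eq_zero_of_mul_mul _ _ fun C => by
      obtain ⟨c, rfl⟩ := hρ C
      rw [← map_mul, ← map_mul]
      exact h c
  obtain ⟨g, hg⟩ := exists_conj_comp_eq (X.eval x) ρ (eval_surjective X x) hρ hx
  exact ⟨g • x, fun f => by rw [X.eval_smul]; exact (hg f).symm⟩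

theorem continuous_of_eval {X : NSpace.{v} n} {Y : NSpace.{w} n} (Φ : X.cstar ≃⋆ₐ[ℂ] Y.cstar)
    {θ : Y → X} (hθ : ∀ y f, X.eval (θ y) f = Y.eval y (Φ f)) : Continuous θ := by
  rw [(isInducing_eval X).continuous_iff]
  refine continuous_pi fun f => ?_
  simp only [Function.comp_apply, hθ]
  exact Y.continuous_eval _

theorem isomorphic_of_equiv {X : NSpace.{v} n} {Y : NSpace.{w} n} (Φ : X.cstar ≃⋆ₐ[ℂ] Y.cstar) :
    NSpace.Isomorphic X Y := by
  choose θ hθ using exists_point_of_equiv Φ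
  choose η hη using exists_point_of_equiv Φ.symm
  let e : X ≃ₜ Y :=
    { toFun := η
      invFun := θ
      left_inv := fun x => eval_injective X fun f => by rw [hθ, hη, Φ.symm_apply_apply]
      right_inv := fun y => eval_injective Y fun f => by rw [hη, hθ, Φ.apply_symm_apply]
      continuous_toFun := continuous_of_eval Φ.symm hη
      continuous_invFun := continuous_of_eval Φ hθ }
  refine ⟨e, e.continuous, fun K hK => e.isClosedEmbedding.isCompact_preimage hK, fun g x => ?_⟩
  refine eval_injective Y fun f => ?_
  change Y.eval (η (g • x)) f = Y.eval (g • η x) f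
  rw [hη, X.eval_smul, Y.eval_smul, hη]

end Uniqueness

end Fell

end

theorem mainTheorem1 (n : ℕ) (hn : 1 ≤ n) (A : Type u) [NonUnitalCStarAlgebra A] :
    (Fell.IsHomogeneous n A ↔
      ∃ X : Fell.NSpace.{max u v} n, Nonempty (A ≃⋆ₐ[ℂ] X.cstar)) ∧
    (Fell.IsHomogeneous n A →
      ∀ (X : Fell.NSpace.{v} n) (Y : Fell.NSpace.{w} n),
        Nonempty (A ≃⋆ₐ[ℂ] X.cstar) → Nonempty (A ≃⋆ₐ[ℂ] Y.cstar) →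
          Fell.NSpace.Isomorphic X Y) := by
  have : NeZero n := ⟨by omega⟩
  refine ⟨⟨fun hA => hA.exists_equiv, fun ⟨X, ⟨Φ⟩⟩ => Fell.isHomogeneous_of_equiv X Φ⟩, ?_⟩
  rintro - X Y ⟨Φ⟩ ⟨Ψ⟩
  exact Fell.isomorphic_of_equiv (Φ.symm.trans Ψ)
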